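/- Let $(X,\delta)$ be a finite metric space with $n$ points and doubling dimension at most $d$ (every ball can be covered by at most $2^d$ balls of half its radius), scaled so that distinct points have distance at least $64$; let $\Delta$ be its largest distance. Let $0<\epsilon<\frac12$ and $1\le f\le n-2$. Write $\mathbf w(E)=\sum_{\{a,b\}\in E}\delta(a,b)$ for a set of edges $E$, and let the lightness of a graph on $X$ be its weight divided by $\mathbf w(\mathrm{MST}(X))$. Let $\log=\log_5$, $\lambda=5^{20}(1+1/\epsilon)$, $r_i=5^i$, $\zeta=\lceil\log\Delta\rceil$, $\mathbf B(p,r)=\{a\in X:\delta(p,a)\le r\}$. *Input.* $G$ is a $(1+\epsilon)$-spanner of $X$ with lightness $\epsilon^{-O(d)}$. $T$ is a greedy net-tree: $N_0=X$ and $N_i\subseteq N_{i-1}$ is an $r_i$-net of $N_{i-1}$ for $1\le i\le\zeta$; the nodes at level $i$ are the pairs $(u,i)$ with $u\in N_i$, and the parent of $(u,i)$, $i<\zeta$, is $(v,i+1)$ with $v$ a point of $N_{i+1}$ closest to $u$ (ties broken arbitrarily). The leaves of a node are the points $u$ such that $(u,0)$ is a descendant of it; every node is a descendant of itself. Distances between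 nodes are those of their points. A cross edge at level $i$ is a pair of distinct level-$i$ nodes at distance at most $\lambda r_i$; $NC[x]$ consists of the level-$i$ node $x$ and its cross neighbours, and $\mathrm{Cross}(A)$ is the set of cross edges with both ends in $A$. The original cross edge of $u,v\in X$ is the pair of ancestors $(\hat u,\hat v)$ of $(u,0),(v,0)$ at the lowest common level where $\delta(\hat u,\hat v)\le\lambda r_i$. *Construction.* Let $E^*_O$ consist, over all edges $(u,v)$ of $G$, of the original cross edge $(\hat u,\hat v)$, of level $i$ say, and of all cross edges of length at least $64r_j$ in $\mathrm{Cross}(NC[y])$, where $i\le j\le\min(\zeta,i+5\log\lambda)$ and $y$ is the level-$j$ ancestor of $\hat u$ or of $\hat v$. Let $\xi=\epsilon^{-\Theta(d)}$, with a sufficiently large constant in the exponent, $c_1=50\xi\log\lambda$, $c_2=51\xi\log\lambda$, $c_3=55\xi\log\lambda$. Start with $E^*=E^*_O$ and the empty graph $H$ on $X$. For $i=0,1,\dots,\zeta-1$ do the following. 1. Mark a level-$i$ node as small if all its leaves have degree at most $c_1f$ in $H$; call it incomplete if it is small and has at most $f$ leaves, and complete otherwise. For every level-$i$ node $x$ having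 an incomplete descendant at a level in $[i-5\log\lambda,\,i]$, add to $E^*$ all edges of length at least $64r_i$ in $\mathrm{Cross}(NC[x])$. Mark the points of degree larger than $c_3f$ in $H$ as saturated. 2. For every level-$i$ edge $(x,y)$ of $E^*$, one after the other in any order, choose surrogate sets $S(x)$, $S(y)$, both with respect to the current $H$, and add to $H$ the edges $M(S(x),S(y))$. Here $S(x)$ consists of $f+1$ arbitrary leaves of $x$ (all of them if there are fewer) if $x$ is small. Otherwise let $S'$ be the set of unsaturated points of degree at least $c_2f$ in $\mathbf B(x,16r_i)$ and $S''$ the set of points of degree less than $c_2f$ in $\mathbf B(x,4r_i)$; if $|S'|\ge f+1$ then $S(x)$ consists of $f+1$ arbitrary points of $S'$, and otherwise of $S'$ and $f+1-|S'|$ arbitrary points of $S''$ (all of $S''$ if it has fewer). $M(S(x),S(y))$ consists of all edges between $S(x)$ and $S(y)$ if one of these sets has fewer than $f+1$ points, and is an arbitrary perfect matching between them otherwise. The incomplete nodes are the vertices of the light net-forest. Let $E_O$, $E_{inc}$ and $E_{com}$ be the sets of edges added to $H$ by the bipartite connections $M(S(x),S(y))$ of, respectively, the cross edges $(x,y)\in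 E^*_O$; the cross edges $(x,y)\in E^*\setminus E^*_O$ with at least one incomplete end; and the cross edges $(x,y)\in E^*\setminus E^*_O$ with two complete ends. **Lemma.** For every outcome of the arbitrary choices, the output graph $H$ has lightness at most $\epsilon^{-O(d)}f^2$. Moreover $E(H)=E_O\cup E_{inc}\cup E_{com}$, and each of $\mathbf w(E_O)$, $\mathbf w(E_{inc})$, $\mathbf w(E_{com})$ is at most $\epsilon^{-O(d)}f^2\,\mathbf w(\mathrm{MST}(X))$. The constants are absolute: there is $C_0$ such that for all $C_1,K$ there is $C$, depending on nothing else, such that the lemma holds with the bound $\epsilon^{-Cd}f^2$ whenever $\epsilon^{-C_0d}\le\xi\le\epsilon^{-C_1d}$ and $G$ has lightness at most $\epsilon^{-Kd}$. -/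

import Mathlib

namespace VFTSpanner

open Set

universe u

section Geometric

variable {X : Type u} [MetricSpace X]

/-- Length of an unordered pair of points. -/
noncomputable def edgeLen : Sym2 X → ℝ :=
  Sym2.lift ⟨fun a b => dist a b, fun a b => dist_comm a b⟩

/-- Total length of a set of edges (the metric spaces below are finite, so this is a finite sum). -/
noncomputable def weight (E : Set (Sym2 X)) : ℝ := ∑ᶠ e ∈ E, edgeLen e

variable (X) in
/-- Weight of a minimum spanning tree of the complete geometric graph on `X`. -/
noncomputable def mstWeight : ℝ :=
  sInf {w : ℝ | ∃ T : SimpleGraph X, T.IsTree ∧ w = weight T.edgeSet}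

/-- Lightness of a geometric graph on `X`: its weight over the weight of a minimum spanning tree. -/
noncomputable def lightness (G : SimpleGraph X) : ℝ := weight G.edgeSet / mstWeight X

/-- Total length of a walk. -/
noncomputable def walkLen {G : SimpleGraph X} {a b : X} (p : G.Walk a b) : ℝ :=
  (p.edges.map edgeLen).sum

/-- `G` is a `t`-spanner: the distance in `G` between any two points is at most `t` times their
distance, i.e. they are joined by a walk of at most that length. -/
def IsSpanner (t : ℝ) (G : SimpleGraph X) : Prop :=
  ∀ a b : X, ∃ p : G.Walk a b, walkLen p ≤ t * dist a b

variable (X) in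
/-- The doubling dimension of `X` is at most `d`: every ball can be covered by at most `2 ^ d`
balls of half its radius. -/
def DoublingDimLE (d : ℝ) : Prop :=
  ∀ (p : X) (r : ℝ), ∃ s : Finset X, (s.card : ℝ) ≤ 2 ^ d ∧
    Metric.closedBall p r ⊆ ⋃ c ∈ s, Metric.closedBall c (r / 2)

/-- `N` is an `r`-net of `P`. -/
def IsNet (r : ℝ) (P N : Set X) : Prop :=
  N ⊆ P ∧ (∀ a ∈ N, ∀ b ∈ N, a ≠ b → r ≤ dist a b) ∧ ∀ v ∈ P, ∃ w ∈ N, dist w v ≤ r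

/-- Degree of a point in a graph on `X`. -/
noncomputable def deg (H : SimpleGraph X) (v : X) : ℕ := (H.neighborSet v).ncard

end Geometric

section Tree

/-- Radius of level `i`. -/
noncomputable def rad (i : ℕ) : ℝ := 5 ^ i

/-- The top level `ζ = ⌈log₅ Δ⌉`, where `Δ` is the largest distance in `X`. -/
noncomputable def topLevel (X : Type u) [MetricSpace X] : ℕ :=
  ⌈Real.logb 5 (Metric.diam (univ : Set X))⌉₊

/-- A greedy net-tree. Its nodes are the pairs `(a, i)` with `i ≤ topLevel X` and `a ∈ net i`;
the parent of a node `(a, i)` below the top level is the node `(parent i a, i + 1)`, and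
`parent i a` is a point of `net (i + 1)` that is closest to `a` (ties are broken arbitrarily). -/
structure NetTree (X : Type u) [MetricSpace X] where
  net : ℕ → Set X
  parent : ℕ → X → X
  net_zero : net 0 = univ
  net_succ : ∀ i < topLevel X, IsNet (rad (i + 1)) (net i) (net (i + 1))
  parent_mem : ∀ i < topLevel X, ∀ a ∈ net i, parent i a ∈ net (i + 1)
  parent_closest : ∀ i < topLevel X, ∀ a ∈ net i, ∀ b ∈ net (i + 1),
    dist a (parent i a) ≤ dist a b

variable {X : Type u} [MetricSpace X]

namespace NetTree

/-- `T.climb j a k` is the ancestor of the node `(a, j)` that lies `k` levels above it. -/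
def climb (T : NetTree X) (j : ℕ) (a : X) : ℕ → X
  | 0 => a
  | k + 1 => T.parent (j + k) (T.climb j a k)

/-- The ancestor at level `i` of the leaf `(a, 0)`. -/
def anc (T : NetTree X) (a : X) (i : ℕ) : X := T.climb 0 a i

/-- The leaves of the subtree rooted at the node `(x, i)`. -/
def leaves (T : NetTree X) (i : ℕ) (x : X) : Set X := {a | T.anc a i = x}

/-- `(w, j)` is a descendant of the node `(x, i)` (a node is a descendant of itself). -/
def IsDesc (T : NetTree X) (j : ℕ) (w : X) (i : ℕ) (x : X) : Prop :=
  w ∈ T.net j ∧ j ≤ i ∧ T.climb j w (i - j) = x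

end NetTree

end Tree

section Cross

variable {X : Type u} [MetricSpace X]

/-- The parameter `λ = 5²⁰ (1 + 1/ε)`. -/
noncomputable def lam (ε : ℝ) : ℝ := 5 ^ 20 * (1 + 1 / ε)

/-- `log₅ λ`. -/
noncomputable def logLam (ε : ℝ) : ℝ := Real.logb 5 (lam ε)

/-- The cross edges at level `i` between nodes of `A`, for a set `A` of level-`i` nodes. -/
def cross (ε : ℝ) (i : ℕ) (A : Set X) : Set (Sym2 X) :=
  {e | ∃ y ∈ A, ∃ z ∈ A, y ≠ z ∧ dist y z ≤ lam ε * rad i ∧ e = s(y, z)}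

/-- `NC[x]`: the level-`i` node `x` together with its cross neighbours. -/
def closedNbrs (T : NetTree X) (ε : ℝ) (i : ℕ) (x : X) : Set X :=
  {y | y ∈ T.net i ∧ dist x y ≤ lam ε * rad i}

/-- `i` is the level of the original cross edge of `(a, 0)` and `(b, 0)`; that edge joins
`T.anc a i` and `T.anc b i`. -/
def IsOriginalLevel (T : NetTree X) (ε : ℝ) (a b : X) (i : ℕ) : Prop :=
  IsLeast {j | j ≤ topLevel X ∧ dist (T.anc a j) (T.anc b j) ≤ lam ε * rad j} i

/-- The level-`j` part of `E*_O`, the set of cross edges that the edges `(a, b)` of `G` give rise to: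
the original cross edge, and the edges of length at least `64 r_j` among the augmented cross edges
of its two ends at the levels `j` from its own level `i` to `i + 5 log λ`. -/
def guidedCross (G : SimpleGraph X) (T : NetTree X) (ε : ℝ) (j : ℕ) : Set (Sym2 X) :=
  {e | j ≤ topLevel X ∧ ∃ a b i, G.Adj a b ∧ IsOriginalLevel T ε a b i ∧
    ((j = i ∧ e = s(T.anc a i, T.anc b i)) ∨
      (i ≤ j ∧ (j : ℝ) ≤ i + 5 * logLam ε ∧ 64 * rad j ≤ edgeLen e ∧
        (e ∈ cross ε j (closedNbrs T ε j (T.anc a j)) ∨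
          e ∈ cross ε j (closedNbrs T ε j (T.anc b j)))))}

end Cross

section Algorithm

variable {X : Type u} [MetricSpace X]

noncomputable def c₁ (ε ξ : ℝ) : ℝ := 50 * logLam ε * ξ
noncomputable def c₂ (ε ξ : ℝ) : ℝ := 51 * logLam ε * ξ
noncomputable def c₃ (ε ξ : ℝ) : ℝ := 55 * logLam ε * ξ

/-- The node `(x, i)` is marked as small, where `H` is the graph at the start of iteration `i`. -/
def IsSmall (T : NetTree X) (ε ξ : ℝ) (f : ℕ) (H : SimpleGraph X) (i : ℕ) (x : X) : Prop :=
  ∀ a ∈ T.leaves i x, (deg H a : ℝ) ≤ c₁ ε ξ * f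

/-- The node `(x, i)` is incomplete: it is small and has at most `f` leaves. The incomplete nodes
are the vertices of the light net-forest. -/
def IsIncomplete (T : NetTree X) (ε ξ : ℝ) (f : ℕ) (H : SimpleGraph X) (i : ℕ) (x : X) : Prop :=
  IsSmall T ε ξ f H i x ∧ (T.leaves i x).ncard ≤ f

/-- The cross edges that iteration `i` adds to `E*`, where `H j` is the graph at the start of
iteration `j`: for every level-`i` node `x` with an incomplete descendant `(w, j)` at a level from
`i - 5 log λ` to `i`, the edges of length at least `64 r_i` among the cross edges in `NC[x]`. -/
def forestCross (T : NetTree X) (ε ξ : ℝ) (f : ℕ) (H : ℕ → SimpleGraph X) (i : ℕ) :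
    Set (Sym2 X) :=
  {e | ∃ x ∈ T.net i,
    (∃ j w, T.IsDesc j w i x ∧ (i : ℝ) - 5 * logLam ε ≤ j ∧ IsIncomplete T ε ξ f (H j) j w) ∧
    64 * rad i ≤ edgeLen e ∧ e ∈ cross ε i (closedNbrs T ε i x)}

/-- `S'`: the points in the ball of radius `16 r_i` with large current degree that are not
saturated (saturation was tested in `H`, the graph at the start of iteration `i`). -/
def semiPool (ε ξ : ℝ) (f : ℕ) (H Hcur : SimpleGraph X) (i : ℕ) (x : X) : Set X :=
  {a | dist x a ≤ 16 * rad i ∧ c₂ ε ξ * f ≤ deg Hcur a ∧ ¬ (c₃ ε ξ * f < deg H a)}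

/-- `S''`: the points in the ball of radius `4 r_i` with small current degree. -/
def cleanPool (ε ξ : ℝ) (f : ℕ) (Hcur : SimpleGraph X) (i : ℕ) (x : X) : Set X :=
  {a | dist x a ≤ 4 * rad i ∧ (deg Hcur a : ℝ) < c₂ ε ξ * f}

/-- `A` is an arbitrary set of `k` elements of `P`, or all of `P` if `P` has fewer elements. -/
def IsChoice (k : ℕ) (P A : Set X) : Prop := A ⊆ P ∧ A.ncard = min k P.ncard

open Classical in
/-- `S` is a possible output of the surrogate selection for the level-`i` node `x`, where `H` is the
graph at the start of iteration `i` and `Hcur` is the current graph. -/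
def IsSurrogateSet (T : NetTree X) (ε ξ : ℝ) (f : ℕ) (H Hcur : SimpleGraph X) (i : ℕ) (x : X)
    (S : Set X) : Prop :=
  if IsSmall T ε ξ f H i x then
    IsChoice (f + 1) (T.leaves i x) S
  else if f + 1 ≤ (semiPool ε ξ f H Hcur i x).ncard then
    IsChoice (f + 1) (semiPool ε ξ f H Hcur i x) S
  else
    ∃ A, IsChoice (f + 1 - (semiPool ε ξ f H Hcur i x).ncard) (cleanPool ε ξ f Hcur i x) A ∧
      S = semiPool ε ξ f H Hcur i x ∪ A

open Classical in
/-- `M` is a bipartite connection between `S₁` and `S₂`: all edges between them if one of them has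
fewer than `f + 1` points, and otherwise an arbitrary perfect matching between them. -/
def IsBipartiteConnection (f : ℕ) (S₁ S₂ : Set X) (M : Set (Sym2 X)) : Prop :=
  if min S₁.ncard S₂.ncard < f + 1 then
    M = {e | ∃ a ∈ S₁, ∃ b ∈ S₂, e = s(a, b)}
  else
    ∃ φ : X → X, BijOn φ S₁ S₂ ∧ M = {e | ∃ a ∈ S₁, e = s(a, φ a)}

/-- An execution of the spanner construction on the input spanner `G` and the net-tree `T`, with all
its arbitrary choices. Iteration `i` processes the level-`i` cross edges in `E*` one after the other,
in an arbitrary order: `graph i k` is the graph `H` after the first `k` of them, and the edge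
processed next joins the nodes `x i k` and `y i k`, which receive the surrogate sets `Sx i k` and
`Sy i k` with the bipartite connection `M i k`. -/
structure Run (G : SimpleGraph X) (T : NetTree X) (ε ξ : ℝ) (f : ℕ) where
  graph : ℕ → ℕ → SimpleGraph X
  num : ℕ → ℕ
  x : ℕ → ℕ → X
  y : ℕ → ℕ → X
  Sx : ℕ → ℕ → Set X
  Sy : ℕ → ℕ → Set X
  M : ℕ → ℕ → Set (Sym2 X)
  graph_zero : graph 0 0 = ⊥
  graph_next : ∀ i < topLevel X, graph (i + 1) 0 = graph i (num i)
  enum : ∀ i < topLevel X, BijOn (fun k => s(x i k, y i k)) (Iio (num i))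
    (guidedCross G T ε i ∪ forestCross T ε ξ f (fun j => graph j 0) i)
  surrogate_x : ∀ i < topLevel X, ∀ k < num i,
    IsSurrogateSet T ε ξ f (graph i 0) (graph i k) i (x i k) (Sx i k)
  surrogate_y : ∀ i < topLevel X, ∀ k < num i,
    IsSurrogateSet T ε ξ f (graph i 0) (graph i k) i (y i k) (Sy i k)
  connection : ∀ i < topLevel X, ∀ k < num i, IsBipartiteConnection f (Sx i k) (Sy i k) (M i k)
  graph_step : ∀ i < topLevel X, ∀ k < num i,
    graph i (k + 1) = graph i k ⊔ SimpleGraph.fromEdgeSet (M i k)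

namespace Run

variable {G : SimpleGraph X} {T : NetTree X} {ε ξ : ℝ} {f : ℕ}

/-- The graph `H` returned by the construction. -/
noncomputable def output (R : Run G T ε ξ f) : SimpleGraph X := R.graph (topLevel X) 0

/-- The node `(x, i)` is incomplete in the execution `R`. -/
def Incomplete (R : Run G T ε ξ f) (i : ℕ) (x : X) : Prop :=
  IsIncomplete T ε ξ f (R.graph i 0) i x

/-- `E_O`: the edges from bipartite connections of cross edges in `E*_O`. -/
def EO (R : Run G T ε ξ f) : Set (Sym2 X) :=
  {e | ∃ i k, i < topLevel X ∧ k < R.num i ∧ e ∈ R.M i k ∧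
    s(R.x i k, R.y i k) ∈ guidedCross G T ε i}

/-- `E_com`: the edges from bipartite connections of cross edges outside `E*_O` with two complete
ends. -/
def Ecom (R : Run G T ε ξ f) : Set (Sym2 X) :=
  {e | ∃ i k, i < topLevel X ∧ k < R.num i ∧ e ∈ R.M i k ∧
    s(R.x i k, R.y i k) ∉ guidedCross G T ε i ∧
    ¬ R.Incomplete i (R.x i k) ∧ ¬ R.Incomplete i (R.y i k)}

/-- `E_inc`: the edges from bipartite connections of cross edges outside `E*_O` with at least one
incomplete end. -/
def Einc (R : Run G T ε ξ f) : Set (Sym2 X) :=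
  {e | ∃ i k, i < topLevel X ∧ k < R.num i ∧ e ∈ R.M i k ∧
    s(R.x i k, R.y i k) ∉ guidedCross G T ε i ∧
    (R.Incomplete i (R.x i k) ∨ R.Incomplete i (R.y i k))}

end Run

end Algorithm

end VFTSpanner

/-!
All three bounds come from one charging scheme (`Run.weight_le_of_charge`). Every surrogate set
has at most `f + 1` points and lies within `16 r_i` of its node, so the bipartite connection of a
level-`i` cross edge consists of at most `(f + 1) ^ 2` edges of length `O(λ r_i)`. In a doubling
space only `λ ^ O(d)` cross edges with levels in a window of length `5 log λ` lie near a given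
point. Hence the weight of a set of connections is at most `λ ^ O(d)` times the total budget of any
family of targets such that each connection is paid for by some target near it. Since
`λ ≤ ε ^ (-49)` and `d ≥ 1`, factors polynomial in `λ` are harmless.

* `E_O` is charged to the edges of `G`: the original level of an edge `(a, b)` satisfies
  `r_i ≤ dist a b`, so the budgets add up to a multiple of the weight of `G`
  (`Run.weight_EO_le`).
* `E_inc` is charged to the incomplete nodes. A connection at such a node has at most `f + 1` edges
  per leaf, and for each leaf the radii of its incomplete ancestors form a geometric sum, dominated
  by the topmost one. The topmost nodes form an antichain and have at most `f` leaves each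
  (`sum_ncard_leaves_mul_rad_le`, `Run.weight_Einc_le`).
* `E_com` is charged to the incomplete nodes `(w, j)` that caused its cross edges. The points close
  to `w` are leaves of `(w, j)`, so there are at most `f` of them, whereas the complete end nearby
  brings more than `f` points to within distance `λ ^ O(1) r_j` of `w`. So the distance from `w` to
  its `f`-th nearest point is `r_j` up to a factor `λ ^ O(1)`. That distance is a `1`-Lipschitz
  function of `w`, whence such nodes of sufficiently different levels are far apart
  (`IsFrontier.rad_le_dist`, `sum_rad_frontier_le`, `Run.weight_Ecom_le`).

In the last two cases the sum of the radii is compared with the minimum spanning tree by a packing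
argument (`sum_le_two_mul_weight`): a connected graph has to cross disjoint balls from their
centres to their boundaries.
-/

namespace VFTSpanner

open Set

/-! ### Lengths and weights -/

section Geometry

variable {X : Type*} [MetricSpace X]

@[simp] lemma edgeLen_mk (a b : X) : edgeLen s(a, b) = dist a b := rfl

lemma edgeLen_nonneg (e : Sym2 X) : 0 ≤ edgeLen e := by
  induction e using Sym2.ind with
  | _ a b => exact dist_nonneg

lemma le_mstWeight [Nonempty X] {c : ℝ}
    (h : ∀ T : SimpleGraph X, T.Connected → c ≤ weight T.edgeSet) : c ≤ mstWeight X := by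
  obtain ⟨T, -, hT⟩ := (SimpleGraph.connected_top (V := X)).exists_isTree_le
  refine le_csInf ⟨_, T, hT, rfl⟩ ?_
  rintro w ⟨T', hT', rfl⟩
  exact h T' hT'.1

variable [Finite X]

lemma weight_eq_sum (E : Set (Sym2 X)) : weight E = ∑ e ∈ E.toFinite.toFinset, edgeLen e :=
  finsum_mem_eq_finite_toFinset_sum _ _

lemma weight_nonneg (E : Set (Sym2 X)) : 0 ≤ weight E := by
  rw [weight_eq_sum]
  exact Finset.sum_nonneg fun e _ => edgeLen_nonneg e

lemma weight_mono {E F : Set (Sym2 X)} (h : E ⊆ F) : weight E ≤ weight F := by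
  rw [weight_eq_sum, weight_eq_sum]
  exact Finset.sum_le_sum_of_subset_of_nonneg (by simpa using h) fun e _ _ => edgeLen_nonneg e

lemma weight_union_le (E F : Set (Sym2 X)) : weight (E ∪ F) ≤ weight E + weight F := by
  classical
  rw [weight_eq_sum, weight_eq_sum, weight_eq_sum, ← Finset.sum_union_inter]
  have : (E ∪ F).toFinite.toFinset = E.toFinite.toFinset ∪ F.toFinite.toFinset := by
    ext; simp
  rw [this]
  exact le_add_of_nonneg_right (Finset.sum_nonneg fun e _ => edgeLen_nonneg e)

lemma weight_biUnion_le {ι : Type*} (J : Finset ι) (F : ι → Set (Sym2 X)) :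
    weight (⋃ i ∈ J, F i) ≤ ∑ i ∈ J, weight (F i) := by
  classical
  induction J using Finset.induction_on with
  | empty => simp [weight]
  | insert i J hi ih =>
    rw [Finset.set_biUnion_insert, Finset.sum_insert hi]
    exact (weight_union_le _ _).trans (by gcongr)

lemma weight_le_card_mul {E : Set (Sym2 X)} {c : ℝ} (h : ∀ e ∈ E, edgeLen e ≤ c) :
    weight E ≤ E.ncard * c := by
  rw [weight_eq_sum, Set.ncard_eq_toFinset_card E E.toFinite, ← nsmul_eq_mul]
  exact Finset.sum_le_card_nsmul _ _ _ (by simpa using h)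

/-! ### Packing bounds -/

/-- The doubling property, iterated `k` times, bounds the size of a separated subset of a ball. -/
lemma ncard_le_of_separated_aux {d : ℝ} (hd : DoublingDimLE X d) {r : ℝ} (k : ℕ) :
    ∀ (R : ℝ) (p : X) (A : Set X), A ⊆ Metric.closedBall p R →
      (∀ a ∈ A, ∀ b ∈ A, a ≠ b → r ≤ dist a b) → R < 2 ^ k * (r / 2) →
      (A.ncard : ℝ) ≤ (2 ^ d) ^ k := by
  induction k with
  | zero =>
    intro R p A hA hsep hR
    have : A.ncard ≤ 1 := by
      rw [Set.ncard_le_one]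
      intro a ha b hb
      by_contra hab
      have h1 := hsep a ha b hb hab
      have h2 := dist_triangle_right a b p
      have h3 := Metric.mem_closedBall.1 (hA ha)
      have h4 := Metric.mem_closedBall.1 (hA hb)
      simp only [pow_zero, one_mul] at hR
      linarith
    simpa using this
  | succ k ih =>
    intro R p A hA hsep hR
    obtain ⟨s, hs, hcov⟩ := hd p R
    have hsub : A ⊆ ⋃ c ∈ s, A ∩ Metric.closedBall c (R / 2) := by
      intro a ha
      have := hcov (hA ha)
      simp only [mem_iUnion, mem_inter_iff] at this ⊢
      obtain ⟨c, hc, hac⟩ := this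
      exact ⟨c, hc, ha, hac⟩
    have h1 : A.ncard ≤ ∑ c ∈ s, (A ∩ Metric.closedBall c (R / 2)).ncard :=
      (Set.ncard_le_ncard hsub (Set.toFinite _)).trans (Finset.set_ncard_biUnion_le _ _)
    have h2 : ∀ c ∈ s, ((A ∩ Metric.closedBall c (R / 2)).ncard : ℝ) ≤ (2 ^ d) ^ k :=
      fun c _ => ih (R / 2) c _ inter_subset_right
        (fun a ha b hb => hsep a ha.1 b hb.1) (by rw [pow_succ] at hR; linarith)
    calc (A.ncard : ℝ) ≤ ∑ c ∈ s, ((A ∩ Metric.closedBall c (R / 2)).ncard : ℝ) := by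
          exact_mod_cast h1
      _ ≤ s.card * (2 ^ d) ^ k := by
          rw [← nsmul_eq_mul]; exact Finset.sum_le_card_nsmul _ _ _ h2
      _ ≤ 2 ^ d * (2 ^ d) ^ k := by gcongr
      _ = (2 ^ d) ^ (k + 1) := by ring

/-- In a space of doubling dimension `d`, an `r`-separated subset of a ball of radius `R` has at
most `(4 R / r) ^ d` points. -/
lemma ncard_le_of_separated {d : ℝ} (hd0 : 0 ≤ d) (hd : DoublingDimLE X d) {r R : ℝ} (hr : 0 < r)
    (hrR : r ≤ 2 * R) {p : X} {A : Set X} (hA : A ⊆ Metric.closedBall p R)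
    (hsep : ∀ a ∈ A, ∀ b ∈ A, a ≠ b → r ≤ dist a b) :
    (A.ncard : ℝ) ≤ (4 * R / r) ^ d := by
  obtain ⟨k, hk1, hk2⟩ := exists_nat_pow_near (x := 2 * R / r) (y := 2)
    ((one_le_div hr).2 hrR) (by norm_num)
  have h := ncard_le_of_separated_aux hd (k + 1) R p A hA hsep (by
    rw [div_lt_iff₀ hr] at hk2; linarith)
  refine h.trans ?_
  rw [← Real.rpow_natCast, ← Real.rpow_mul (by norm_num), mul_comm, Real.rpow_mul (by norm_num),
    Real.rpow_natCast]
  refine Real.rpow_le_rpow (by positivity) ?_ hd0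
  rw [pow_succ]
  calc (2 : ℝ) ^ k * 2 ≤ 2 * R / r * 2 := by gcongr
    _ = 4 * R / r := by ring

/-- A space with at least two points does not have doubling dimension less than `1`: a ball whose
radius is the least distance needs two balls of half that radius. -/
lemma one_le_of_doublingDimLE [Nontrivial X] {d : ℝ} (hd : DoublingDimLE X d) : 1 ≤ d := by
  obtain ⟨a₀, b₀, hab₀⟩ := exists_pair_ne X
  have : Nonempty {q : X × X // q.1 ≠ q.2} := ⟨⟨(a₀, b₀), hab₀⟩⟩
  obtain ⟨⟨⟨a, b⟩, hab⟩, hmin⟩ := Finite.exists_min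
    (fun q : {q : X × X // q.1 ≠ q.2} => dist q.1.1 q.1.2)
  have hmin' : ∀ p q : X, p ≠ q → dist a b ≤ dist p q := fun p q h => hmin ⟨(p, q), h⟩
  simp only at hab
  have hpos : 0 < dist a b := dist_pos.2 hab
  obtain ⟨s, hs, hcov⟩ := hd a (dist a b)
  have hsmall : ∀ c z : X, z ∈ Metric.closedBall c (dist a b / 2) → z = c := by
    intro c z hz
    by_contra h
    have := hmin' z c h
    rw [Metric.mem_closedBall] at hz
    linarith
  have hmem : ∀ z ∈ Metric.closedBall a (dist a b), z ∈ s := by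
    intro z hz
    have := hcov hz
    simp only [mem_iUnion] at this
    obtain ⟨c, hc, hzc⟩ := this
    rwa [hsmall c z hzc]
  have h2 : 2 ≤ s.card := by
    exact Finset.one_lt_card.2 ⟨a, hmem a (Metric.mem_closedBall_self hpos.le), b,
      hmem b (by simp [dist_comm]), hab⟩
  have h3 : (2 : ℝ) ^ (1 : ℝ) ≤ 2 ^ d := by
    rw [Real.rpow_one]
    exact le_trans (by exact_mod_cast h2) hs
  exact (Real.rpow_le_rpow_left_iff (by norm_num)).1 h3

/-! ### Lower bounds for the weight of a minimum spanning tree -/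

/-- The variation of a real function along an unordered pair. -/
def variation {V : Type*} (g : V → ℝ) : Sym2 V → ℝ :=
  Sym2.lift ⟨fun a b => |g a - g b|, fun a b => abs_sub_comm (g a) (g b)⟩

@[simp] lemma variation_mk {V : Type*} (g : V → ℝ) (a b : V) :
    variation g s(a, b) = |g a - g b| := rfl

lemma variation_nonneg {V : Type*} (g : V → ℝ) (e : Sym2 V) : 0 ≤ variation g e := by
  induction e using Sym2.ind with
  | _ a b => exact abs_nonneg _

lemma abs_sub_le_sum_variation {V : Type*} {G : SimpleGraph V} (g : V → ℝ) {a b : V}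
    (p : G.Walk a b) : |g a - g b| ≤ (p.edges.map (variation g)).sum := by
  induction p with
  | nil => simp
  | @cons u v w h p ih =>
    simp only [SimpleGraph.Walk.edges_cons, List.map_cons, List.sum_cons, variation_mk]
    exact (abs_sub_le _ (g v) _).trans (by gcongr)

lemma abs_sub_le_sum_edges {V : Type*} [Finite V] {G : SimpleGraph V} (hG : G.Connected)
    (g : V → ℝ) (a b : V) :
    |g a - g b| ≤ ∑ e ∈ G.edgeSet.toFinite.toFinset, variation g e := by
  classical
  obtain ⟨p, hp⟩ := (hG a b).exists_isPath
  refine (abs_sub_le_sum_variation g p).trans ?_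
  rw [← List.sum_toFinset _ hp.isTrail.edges_nodup]
  refine Finset.sum_le_sum_of_subset_of_nonneg ?_ fun e _ _ => variation_nonneg g e
  intro e he
  simpa using p.edges_subset_edgeSet (by simpa using he)

/-- For balls around `p i` of radii `ρ i / 2` that overlap at most in their boundaries, the depths
`max (ρ i / 2 - dist (p i) ·) 0` in the balls have total variation at most `dist a b` between
two points `a` and `b`. -/
lemma sum_abs_depth_sub_le {Y ι : Type*} [MetricSpace Y] (J : Finset ι) (p : ι → Y) (ρ : ι → ℝ)
    (hsep : ∀ i ∈ J, ∀ j ∈ J, i ≠ j → (ρ i + ρ j) / 2 ≤ dist (p i) (p j)) (a b : Y) :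
    ∑ i ∈ J, |max (ρ i / 2 - dist (p i) a) 0 - max (ρ i / 2 - dist (p i) b) 0| ≤ dist a b := by
  classical
  rcases J.eq_empty_or_nonempty with rfl | ⟨i₀, hi₀⟩
  · simp
  set h : ι → Y → ℝ := fun i z => max (ρ i / 2 - dist (p i) z) 0 with hh
  have hlip : ∀ i, |h i a - h i b| ≤ dist a b := by
    intro i
    refine (abs_max_sub_max_le_abs _ _ _).trans ?_
    have h1 := dist_triangle (p i) a b
    have h2 := dist_triangle_right (p i) a b
    rw [abs_le]
    constructor <;> linarith
  have hnn : ∀ i z, 0 ≤ h i z := fun i z => le_max_right _ _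
  -- Each point lies in the interior of at most one ball.
  have huniq : ∀ z : Y, ∃ i ∈ J, ∀ j ∈ J, j ≠ i → h j z = 0 := by
    intro z
    by_cases hz : ∃ i ∈ J, 0 < h i z
    · obtain ⟨i, hi, hiz⟩ := hz
      refine ⟨i, hi, fun j hj hji => ?_⟩
      by_contra hne
      have hjz : 0 < h j z := lt_of_le_of_ne (hnn j z) (Ne.symm hne)
      have h1 : 0 < ρ i / 2 - dist (p i) z := by simpa [hh] using hiz
      have h2 : 0 < ρ j / 2 - dist (p j) z := by simpa [hh] using hjz
      have h3 := hsep j hj i hi hji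
      have h4 := dist_triangle_right (p j) (p i) z
      linarith
    · push Not at hz
      exact ⟨i₀, hi₀, fun j hj _ => le_antisymm (hz j hj) (hnn j z)⟩
  obtain ⟨i, hi, hia⟩ := huniq a
  obtain ⟨j, hj, hjb⟩ := huniq b
  by_cases hij : i = j
  · subst hij
    rw [Finset.sum_eq_single_of_mem i hi fun k hk hki => by
      have := hia k hk hki
      have := hjb k hk hki
      simp_all]
    exact hlip i
  · have hsupp : ∑ k ∈ J, |h k a - h k b| = ∑ k ∈ {i, j}, |h k a - h k b| := by
      symm
      refine Finset.sum_subset (by simp [Finset.insert_subset_iff, hi, hj]) fun k hk hkn => ?_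
      simp only [Finset.mem_insert, Finset.mem_singleton, not_or] at hkn
      rw [hia k hk hkn.1, hjb k hk hkn.2]
      simp
    have e1 : h i b = 0 := hjb i hi hij
    have e2 : h j a = 0 := hia j hj (Ne.symm hij)
    change ∑ k ∈ J, |h k a - h k b| ≤ dist a b
    rw [hsupp, Finset.sum_pair hij, e1, e2, sub_zero, zero_sub, abs_neg, abs_of_nonneg (hnn _ _),
      abs_of_nonneg (hnn _ _)]
    have l1 := hlip i
    have l2 := hlip j
    rw [e1, sub_zero, abs_of_nonneg (hnn _ _)] at l1
    rw [e2, zero_sub, abs_neg, abs_of_nonneg (hnn _ _)] at l2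
    rcases (hnn i a).eq_or_lt with h0 | hpos
    · rw [← h0, zero_add]; exact l2
    rcases (hnn j b).eq_or_lt with h0 | hpos'
    · rw [← h0, add_zero]; exact l1
    have f1 : h i a = ρ i / 2 - dist (p i) a :=
      max_eq_left (le_of_lt (by simpa [hh] using hpos))
    have f2 : h j b = ρ j / 2 - dist (p j) b :=
      max_eq_left (le_of_lt (by simpa [hh] using hpos'))
    have h3 := hsep i hi j hj hij
    have h4 := dist_triangle4 (p i) a b (p j)
    rw [dist_comm b (p j)] at h4
    linarith

/-- A connected graph crosses each ball of a packing from its centre to its boundary. -/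
lemma sum_le_two_mul_weight {ι : Type*} {G : SimpleGraph X} (hG : G.Connected) (J : Finset ι)
    (p : ι → X) (ρ : ι → ℝ) (hρ : ∀ i ∈ J, 0 ≤ ρ i)
    (hsep : ∀ i ∈ J, ∀ j ∈ J, i ≠ j → (ρ i + ρ j) / 2 ≤ dist (p i) (p j))
    (hfar : ∀ i ∈ J, ∃ y, ρ i / 2 ≤ dist (p i) y) :
    ∑ i ∈ J, ρ i ≤ 2 * weight G.edgeSet := by
  have h1 : ∑ i ∈ J, ρ i / 2 ≤ ∑ i ∈ J, ∑ e ∈ G.edgeSet.toFinite.toFinset,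
      variation (fun z => max (ρ i / 2 - dist (p i) z) 0) e := by
    refine Finset.sum_le_sum fun i hi => ?_
    obtain ⟨y, hy⟩ := hfar i hi
    refine le_trans ?_ (abs_sub_le_sum_edges hG _ (p i) y)
    rw [dist_self, max_eq_right (by linarith : ρ i / 2 - dist (p i) y ≤ 0), sub_zero, sub_zero,
      max_eq_left (by linarith [hρ i hi])]
    exact le_abs_self _
  have h2 : ∑ i ∈ J, ∑ e ∈ G.edgeSet.toFinite.toFinset,
      variation (fun z => max (ρ i / 2 - dist (p i) z) 0) e ≤ weight G.edgeSet := by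
    rw [Finset.sum_comm, weight_eq_sum]
    refine Finset.sum_le_sum fun e _ => ?_
    induction e using Sym2.ind with
    | _ a b => exact sum_abs_depth_sub_le J p ρ hsep a b
  have h3 := h1.trans h2
  rw [← Finset.sum_div] at h3
  linarith

lemma sum_le_two_mul_mstWeight [Nonempty X] {ι : Type*} (J : Finset ι)
    (p : ι → X) (ρ : ι → ℝ) (hρ : ∀ i ∈ J, 0 ≤ ρ i)
    (hsep : ∀ i ∈ J, ∀ j ∈ J, i ≠ j → (ρ i + ρ j) / 2 ≤ dist (p i) (p j))
    (hfar : ∀ i ∈ J, ∃ y, ρ i / 2 ≤ dist (p i) y) :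
    ∑ i ∈ J, ρ i ≤ 2 * mstWeight X := by
  have := le_mstWeight (X := X) (c := (∑ i ∈ J, ρ i) / 2) fun T hT => by
    linarith [sum_le_two_mul_weight hT J p ρ hρ hsep hfar]
  linarith

lemma mstWeight_nonneg [Nonempty X] : 0 ≤ mstWeight X :=
  le_mstWeight fun _ _ => weight_nonneg _

lemma mstWeight_pos [Nontrivial X] : 0 < mstWeight X := by
  obtain ⟨a, b, hab⟩ := exists_pair_ne X
  have hpos : 0 < dist a b := dist_pos.2 hab
  have := sum_le_two_mul_mstWeight (X := X) (Finset.univ : Finset Unit) (fun _ => a)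
    (fun _ => dist a b) (fun _ _ => hpos.le) (fun i _ j _ hij => absurd rfl hij)
    (fun _ _ => ⟨b, by linarith⟩)
  simp only [Finset.univ_unique, Finset.sum_singleton] at this
  linarith

end Geometry

/-! ### The net-tree -/

section Tree

variable {X : Type*} [MetricSpace X]

lemma rad_pos (i : ℕ) : 0 < rad i := by unfold rad; positivity

lemma rad_succ (i : ℕ) : rad (i + 1) = 5 * rad i := by unfold rad; ring

lemma rad_mono {i j : ℕ} (h : i ≤ j) : rad i ≤ rad j := pow_le_pow_right₀ (by norm_num) h

lemma rad_add (i j : ℕ) : rad (i + j) = rad i * 5 ^ j := by unfold rad; ring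

lemma rad_lt_diam {i : ℕ} (hi : i < topLevel X) : rad i < Metric.diam (univ : Set X) := by
  rw [topLevel, Nat.lt_ceil] at hi
  have hD : 0 < Metric.diam (univ : Set X) := by
    refine lt_of_le_of_ne Metric.diam_nonneg fun h => ?_
    rw [← h, Real.logb_zero] at hi
    exact absurd hi (by simp)
  rw [Real.lt_logb_iff_rpow_lt (by norm_num) hD, Real.rpow_natCast] at hi
  exact hi

lemma exists_half_rad_le_dist {i : ℕ} (hi : i < topLevel X) (x : X) :
    ∃ y, rad i / 2 ≤ dist x y := by
  by_contra! h
  refine (rad_lt_diam hi).not_ge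
    (Metric.diam_le_of_forall_dist_le (rad_pos i).le fun a _ b _ => ?_)
  have h1 := dist_triangle_left a b x
  linarith [h a, h b]

/-- The form of the packing bound for minimum spanning trees used for families of nodes. -/
lemma sum_rad_le_mstWeight [Finite X] [Nonempty X] {ι : Type*} (J : Finset ι) (p : ι → X)
    (lvl : ι → ℕ) (hlvl : ∀ τ ∈ J, lvl τ < topLevel X)
    (hsep : ∀ σ ∈ J, ∀ τ ∈ J, σ ≠ τ → lvl σ ≤ lvl τ → rad (lvl τ) / 8 ≤ dist (p σ) (p τ)) :
    ∑ τ ∈ J, rad (lvl τ) ≤ 16 * mstWeight X := by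
  have h := sum_le_two_mul_mstWeight J p (fun τ => rad (lvl τ) / 8)
    (fun τ _ => by have := rad_pos (lvl τ); positivity) ?_ ?_
  · rw [← Finset.sum_div] at h
    linarith
  · intro σ hσ τ hτ hne
    rcases le_total (lvl σ) (lvl τ) with hle | hle
    · have := hsep σ hσ τ hτ hne hle
      have := rad_mono hle
      linarith
    · have := hsep τ hτ σ hσ hne.symm hle
      have := rad_mono hle
      rw [dist_comm]
      linarith
  · intro τ hτ
    obtain ⟨y, hy⟩ := exists_half_rad_le_dist (hlvl τ hτ) (p τ)
    exact ⟨y, by linarith [rad_pos (lvl τ)]⟩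

namespace NetTree

variable (T : NetTree X)

lemma anc_succ (a : X) (i : ℕ) : T.anc a (i + 1) = T.parent i (T.anc a i) := by
  simp [anc, climb]

@[simp] lemma anc_zero (a : X) : T.anc a 0 = a := rfl

lemma anc_mem (a : X) {i : ℕ} (hi : i ≤ topLevel X) : T.anc a i ∈ T.net i := by
  induction i with
  | zero => simp [T.net_zero]
  | succ i ih =>
    rw [anc_succ]
    exact T.parent_mem i hi _ (ih (by omega))

lemma rad_le_dist (hsep : ∀ a b : X, a ≠ b → 64 ≤ dist a b) {i : ℕ} (hi : i ≤ topLevel X) {a b : X}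
    (ha : a ∈ T.net i) (hb : b ∈ T.net i) (hab : a ≠ b) : rad i ≤ dist a b := by
  cases i with
  | zero =>
    have := hsep a b hab
    simp only [rad, pow_zero]
    linarith
  | succ i => exact (T.net_succ i hi).2.1 a ha b hb hab

lemma dist_parent_le {i : ℕ} (hi : i < topLevel X) {a : X} (ha : a ∈ T.net i) :
    dist a (T.parent i a) ≤ rad (i + 1) := by
  obtain ⟨w, hw, hwa⟩ := (T.net_succ i hi).2.2 a ha
  rw [dist_comm] at hwa
  exact (T.parent_closest i hi a ha w hw).trans hwa

lemma climb_mem_and_dist_le {j : ℕ} {w : X} (hw : w ∈ T.net j) (k : ℕ) (hk : j + k ≤ topLevel X) :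
    T.climb j w k ∈ T.net (j + k) ∧ dist w (T.climb j w k) ≤ 5 / 4 * (rad (j + k) - rad j) := by
  induction k with
  | zero => simpa [climb] using hw
  | succ k ih =>
    obtain ⟨h1, h2⟩ := ih (by omega)
    have hlt : j + k < topLevel X := by omega
    refine ⟨T.parent_mem _ hlt _ h1, ?_⟩
    have h3 := dist_triangle w (T.climb j w k) (T.climb j w (k + 1))
    have h4 : dist (T.climb j w k) (T.climb j w (k + 1)) ≤ rad (j + k + 1) :=
      T.dist_parent_le hlt h1
    rw [← add_assoc, rad_succ] at *
    linarith

lemma dist_anc_le (a : X) {i : ℕ} (hi : i ≤ topLevel X) :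
    dist a (T.anc a i) ≤ 5 / 4 * (rad i - 1) := by
  have := (T.climb_mem_and_dist_le (j := 0) (w := a) (by simp [T.net_zero]) i (by omega)).2
  simpa [anc, rad] using this

lemma IsDesc.dist_le {T : NetTree X} {i j : ℕ} {w x : X} (h : T.IsDesc j w i x)
    (hi : i ≤ topLevel X) : dist w x ≤ 5 / 4 * rad i := by
  obtain ⟨hw, hji, rfl⟩ := h
  have := (T.climb_mem_and_dist_le hw (i - j) (by omega)).2
  rw [Nat.add_sub_cancel' hji] at this
  linarith [rad_pos j]

lemma dist_le_of_mem_leaves {i : ℕ} (hi : i ≤ topLevel X) {x a : X} (ha : a ∈ T.leaves i x) :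
    dist x a ≤ 5 / 4 * rad i := by
  have := T.dist_anc_le a hi
  rw [show T.anc a i = x from ha, dist_comm] at this
  linarith

/-- A node has all points close to it among its leaves. -/
lemma anc_eq_of_dist_lt (hsep : ∀ a b : X, a ≠ b → 64 ≤ dist a b) {i : ℕ} (hi : i ≤ topLevel X)
    {x a : X} (hx : x ∈ T.net i) (ha : dist x a < rad i / 4) : T.anc a i = x := by
  cases i with
  | zero =>
    by_contra h
    have := hsep x a (Ne.symm h)
    simp only [rad, pow_zero] at ha
    linarith
  | succ i =>
    by_contra h
    have h1 := T.dist_anc_le a (i := i) (by omega)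
    have h2 := T.parent_closest i hi (T.anc a i) (T.anc_mem a (by omega)) x hx
    have h3 := T.rad_le_dist hsep hi (T.anc_mem a hi) hx h
    have h4 := dist_triangle_left (T.anc a (i + 1)) x (T.anc a i)
    have h5 := dist_triangle_left (T.anc a i) x a
    rw [← anc_succ] at h2
    rw [dist_comm] at ha
    rw [rad_succ] at ha h3
    linarith

lemma anc_self (hsep : ∀ a b : X, a ≠ b → 64 ≤ dist a b) {i : ℕ} (hi : i ≤ topLevel X) {x : X}
    (hx : x ∈ T.net i) : T.anc x i = x :=
  T.anc_eq_of_dist_lt hsep hi hx (by rw [dist_self]; linarith [rad_pos i])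

lemma anc_eq_anc {a b : X} {i j : ℕ} (hij : i ≤ j) (h : T.anc a i = T.anc b i) :
    T.anc a j = T.anc b j := by
  induction j, hij using Nat.le_induction with
  | base => exact h
  | succ k _ ih => rw [anc_succ, anc_succ, ih]

end NetTree

end Tree

/-! ### Cross edges -/

section Cross

variable {X : Type*} [MetricSpace X] {T : NetTree X} {ε : ℝ}

lemma le_lam (hε : 0 < ε) : 5 ^ 20 ≤ lam ε := by
  have : 0 < 1 / ε := by positivity
  unfold lam
  nlinarith

lemma logLam_nonneg (hε : 0 < ε) : 0 ≤ logLam ε :=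
  Real.logb_nonneg (by norm_num) (le_trans (by norm_num) (le_lam hε))

/-- The number of levels spanned by a window of length `5 log λ`. -/
noncomputable def window (ε : ℝ) : ℕ := ⌊5 * logLam ε⌋₊

lemma pow_window_le (hε : 0 < ε) : (5 : ℝ) ^ window ε ≤ lam ε ^ 5 := by
  have hpos : 0 < lam ε := lt_of_lt_of_le (by norm_num) (le_lam hε)
  calc (5 : ℝ) ^ window ε = 5 ^ (window ε : ℝ) := (Real.rpow_natCast _ _).symm
    _ ≤ 5 ^ (5 * logLam ε) := by
        refine Real.rpow_le_rpow_of_exponent_le (by norm_num) (Nat.floor_le ?_)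
        have := logLam_nonneg hε
        positivity
    _ = (5 ^ logLam ε) ^ (5 : ℝ) := by rw [← Real.rpow_mul (by norm_num), mul_comm]
    _ = lam ε ^ 5 := by
        rw [logLam, Real.rpow_logb (by norm_num) (by norm_num) hpos]
        norm_cast

lemma rad_le_of_le_add_window (hε : 0 < ε) {i j : ℕ} (h : j ≤ i + window ε) :
    rad j ≤ lam ε ^ 5 * rad i :=
  calc rad j ≤ rad (i + window ε) := rad_mono h
    _ = rad i * 5 ^ window ε := rad_add _ _
    _ ≤ rad i * lam ε ^ 5 := by gcongr; exacts [(rad_pos i).le, pow_window_le hε]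
    _ = lam ε ^ 5 * rad i := mul_comm _ _

lemma le_add_window {i j : ℕ} (h : (j : ℝ) ≤ i + 5 * logLam ε) : j ≤ i + window ε := by
  rcases le_total j i with hji | hij
  · omega
  have : j - i ≤ window ε := by
    refine Nat.le_floor ?_
    rw [Nat.cast_sub hij]
    linarith
  omega

lemma mem_cross_iff {i : ℕ} {A : Set X} {x y : X} :
    s(x, y) ∈ cross ε i A ↔ x ∈ A ∧ y ∈ A ∧ x ≠ y ∧ dist x y ≤ lam ε * rad i := by
  constructor
  · rintro ⟨u, hu, v, hv, hne, hd, he⟩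
    rcases Sym2.eq_iff.1 he with ⟨rfl, rfl⟩ | ⟨rfl, rfl⟩
    · exact ⟨hu, hv, hne, hd⟩
    · exact ⟨hv, hu, hne.symm, by rwa [dist_comm]⟩
  · rintro ⟨hx, hy, hne, hd⟩
    exact ⟨x, hx, y, hy, hne, hd, rfl⟩

lemma IsOriginalLevel.symm {a b : X} {i : ℕ} (h : IsOriginalLevel T ε a b i) :
    IsOriginalLevel T ε b a i := by
  simpa only [IsOriginalLevel, dist_comm] using h

/-- The ancestors just below the original level are far apart. -/
lemma IsOriginalLevel.lt_dist_anc {a b : X} {i : ℕ} (h : IsOriginalLevel T ε a b (i + 1)) :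
    lam ε * rad i < dist (T.anc a i) (T.anc b i) := by
  by_contra! hle
  have := h.2 ⟨by have := h.1.1; omega, hle⟩
  omega

lemma IsOriginalLevel.le_dist_anc (hsep : ∀ a b : X, a ≠ b → 64 ≤ dist a b) (hε : 0 < ε) {a b : X}
    (hab : a ≠ b) {i : ℕ} (h : IsOriginalLevel T ε a b i) :
    64 * rad i ≤ dist (T.anc a i) (T.anc b i) := by
  cases i with
  | zero => simpa [rad] using hsep a b hab
  | succ i =>
    have hi : i < topLevel X := h.1.1
    have h1 := h.lt_dist_anc
    have h2 := T.dist_parent_le hi (T.anc_mem a hi.le)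
    have h3 := T.dist_parent_le hi (T.anc_mem b hi.le)
    have h4 := dist_triangle4 (T.anc a i) (T.anc a (i + 1)) (T.anc b (i + 1)) (T.anc b i)
    rw [dist_comm (T.anc b (i + 1)) (T.anc b i)] at h4
    rw [← NetTree.anc_succ] at h2 h3
    have h5 := le_lam hε
    have h6 := rad_pos i
    rw [rad_succ] at *
    nlinarith

lemma IsOriginalLevel.rad_le_dist (hsep : ∀ a b : X, a ≠ b → 64 ≤ dist a b) (hε : 0 < ε) {a b : X}
    (hab : a ≠ b) {i : ℕ} (h : IsOriginalLevel T ε a b i) : rad i ≤ dist a b := by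
  have h1 := h.le_dist_anc hsep hε hab
  have h2 := T.dist_anc_le a h.1.1
  have h3 := T.dist_anc_le b h.1.1
  have h4 := dist_triangle4 (T.anc a i) a b (T.anc b i)
  rw [dist_comm _ a] at h4
  linarith [rad_pos i]

lemma guidedCross_spec (hsep : ∀ a b : X, a ≠ b → 64 ≤ dist a b) (hε : 0 < ε) {G : SimpleGraph X}
    {j : ℕ} {x y : X} (h : s(x, y) ∈ guidedCross G T ε j) :
    x ∈ T.net j ∧ y ∈ T.net j ∧ 64 * rad j ≤ dist x y ∧ dist x y ≤ lam ε * rad j := by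
  obtain ⟨hj, a, b, i, hab, hi, ⟨rfl, he⟩ | ⟨-, -, hlen, he⟩⟩ := h
  · have h1 := hi.le_dist_anc hsep hε hab.ne
    rcases Sym2.eq_iff.1 he with ⟨rfl, rfl⟩ | ⟨rfl, rfl⟩
    · exact ⟨T.anc_mem a hj, T.anc_mem b hj, h1, hi.1.2⟩
    · rw [dist_comm]
      exact ⟨T.anc_mem b hj, T.anc_mem a hj, h1, hi.1.2⟩
  · rw [mem_cross_iff, mem_cross_iff] at he
    rcases he with ⟨h1, h2, -, h3⟩ | ⟨h1, h2, -, h3⟩ <;> exact ⟨h1.1, h2.1, hlen, h3⟩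

lemma forestCross_spec {ξ : ℝ} {f : ℕ} {H : ℕ → SimpleGraph X} {i : ℕ} {x y : X}
    (h : s(x, y) ∈ forestCross T ε ξ f H i) :
    x ∈ T.net i ∧ y ∈ T.net i ∧ 64 * rad i ≤ dist x y ∧ dist x y ≤ lam ε * rad i := by
  obtain ⟨z, -, -, hlen, he⟩ := h
  rw [mem_cross_iff] at he
  exact ⟨he.1.1, he.2.1.1, hlen, he.2.2.2⟩

/-- Cross edges coming from an edge of `G` of original level `i` lie close to that edge. -/
lemma exists_of_mem_guidedCross (hε : 0 < ε) {G : SimpleGraph X} {j : ℕ} {x y : X}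
    (h : s(x, y) ∈ guidedCross G T ε j) :
    ∃ a b i, G.Adj a b ∧ IsOriginalLevel T ε a b i ∧ i ≤ j ∧ j ≤ i + window ε ∧
      ∀ p, (p = a ∨ p = b) → dist p x ≤ 5 * lam ε * rad j ∧ dist p y ≤ 5 * lam ε * rad j := by
  obtain ⟨hj, a, b, i, hab, hi, h⟩ := h
  have hlam := le_lam hε
  have hr := rad_pos j
  have hl : 5 ^ 20 * rad j ≤ lam ε * rad j := by gcongr
  have ha := T.dist_anc_le a hj
  have hb := T.dist_anc_le b hj
  rcases h with ⟨rfl, he⟩ | ⟨hij, hji, -, he⟩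
  · refine ⟨a, b, j, hab, hi, le_rfl, by omega, ?_⟩
    have hd : dist (T.anc a j) (T.anc b j) ≤ lam ε * rad j := hi.1.2
    have h1 := dist_triangle a (T.anc a j) (T.anc b j)
    have h2 := dist_triangle b (T.anc b j) (T.anc a j)
    rw [dist_comm (T.anc b j)] at h2
    rcases Sym2.eq_iff.1 he with ⟨rfl, rfl⟩ | ⟨rfl, rfl⟩ <;> rintro p (rfl | rfl) <;>
      constructor <;> linarith
  · refine ⟨a, b, i, hab, hi, hij, le_add_window hji, ?_⟩
    -- Passing from `a` and `b` to their ancestors costs less than `λ r_j`, so that nodes near the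
    -- ancestor of one of them are also near the other one.
    have hab' : dist a b ≤ 2 * (lam ε * rad j) := by
      have h1 := dist_triangle4 a (T.anc a i) (T.anc b i) b
      rw [dist_comm (T.anc b i) b] at h1
      have h2 := T.dist_anc_le a hi.1.1
      have h3 := T.dist_anc_le b hi.1.1
      have h4 : dist (T.anc a i) (T.anc b i) ≤ lam ε * rad i := hi.1.2
      have h5 := rad_mono hij
      have h6 : lam ε * rad i ≤ lam ε * rad j :=
        mul_le_mul_of_nonneg_left h5 (by linarith)
      linarith
    rw [mem_cross_iff, mem_cross_iff] at he
    rcases he with ⟨⟨-, hx⟩, ⟨-, hy⟩, -⟩ | ⟨⟨-, hx⟩, ⟨-, hy⟩, -⟩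
    · have h1 := dist_triangle a (T.anc a j) x
      have h2 := dist_triangle a (T.anc a j) y
      have h3 := dist_triangle_left b x a
      have h4 := dist_triangle_left b y a
      rintro p (rfl | rfl) <;> constructor <;> linarith
    · have h1 := dist_triangle b (T.anc b j) x
      have h2 := dist_triangle b (T.anc b j) y
      have h3 := dist_triangle a b x
      have h4 := dist_triangle a b y
      rintro p (rfl | rfl) <;> constructor <;> linarith

end Cross

/-! ### Surrogate sets and bipartite connections -/

section Surrogates

variable {X : Type*} [MetricSpace X] {T : NetTree X} {ε ξ : ℝ} {f : ℕ}

lemma IsSurrogateSet.dist_le {H Hcur : SimpleGraph X} {i : ℕ} (hi : i ≤ topLevel X) {x : X}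
    {S : Set X} (h : IsSurrogateSet T ε ξ f H Hcur i x S) {a : X} (ha : a ∈ S) :
    dist x a ≤ 16 * rad i := by
  have hr := rad_pos i
  unfold IsSurrogateSet at h
  split_ifs at h
  · linarith [T.dist_le_of_mem_leaves hi (h.1 ha)]
  · exact (h.1 ha).1
  · obtain ⟨A, hA, rfl⟩ := h
    rcases ha with ha | ha
    · exact ha.1
    · linarith [(hA.1 ha).1]

lemma IsSurrogateSet.ncard_le {H Hcur : SimpleGraph X} {i : ℕ} {x : X} {S : Set X}
    (h : IsSurrogateSet T ε ξ f H Hcur i x S) : S.ncard ≤ f + 1 := by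
  unfold IsSurrogateSet at h
  split_ifs at h
  · exact h.2.trans_le (min_le_left _ _)
  · exact h.2.trans_le (min_le_left _ _)
  · obtain ⟨A, hA, rfl⟩ := h
    have h1 := hA.2.trans_le (min_le_left _ _)
    have h2 := Set.ncard_union_le (semiPool ε ξ f H Hcur i x) A
    omega

lemma IsSurrogateSet.ncard_le_ncard_leaves [Finite X] {H Hcur : SimpleGraph X} {i : ℕ} {x : X}
    {S : Set X}
    (h : IsSurrogateSet T ε ξ f H Hcur i x S) (hx : IsIncomplete T ε ξ f H i x) :
    S.ncard ≤ (T.leaves i x).ncard := by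
  unfold IsSurrogateSet at h
  rw [if_pos hx.1] at h
  exact Set.ncard_le_ncard h.1 (Set.toFinite _)

lemma IsBipartiteConnection.subset_image {V : Type*} {f : ℕ} {S₁ S₂ : Set V} {M : Set (Sym2 V)}
    (h : IsBipartiteConnection f S₁ S₂ M) : M ⊆ (fun q : V × V => s(q.1, q.2)) '' (S₁ ×ˢ S₂) := by
  unfold IsBipartiteConnection at h
  split_ifs at h
  · subst h
    rintro _ ⟨a, ha, b, hb, rfl⟩
    exact ⟨(a, b), ⟨ha, hb⟩, rfl⟩
  · obtain ⟨φ, hφ, rfl⟩ := h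
    rintro _ ⟨a, ha, rfl⟩
    exact ⟨(a, φ a), ⟨ha, hφ.mapsTo ha⟩, rfl⟩

lemma IsBipartiteConnection.ncard_le {V : Type*} [Finite V] {f : ℕ} {S₁ S₂ : Set V}
    {M : Set (Sym2 V)}
    (h : IsBipartiteConnection f S₁ S₂ M) : M.ncard ≤ S₁.ncard * S₂.ncard := by
  rw [← Set.ncard_prod]
  exact (Set.ncard_le_ncard h.subset_image (Set.toFinite _)).trans
    (Set.ncard_image_le (Set.toFinite _))

end Surrogates

/-! ### Executions of the construction -/

namespace Run

variable {X : Type*} [MetricSpace X] {G : SimpleGraph X} {T : NetTree X} {ε ξ : ℝ} {f : ℕ}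
  (R : Run G T ε ξ f)

lemma mem_cross {i k : ℕ} (hi : i < topLevel X) (hk : k < R.num i) :
    s(R.x i k, R.y i k) ∈ guidedCross G T ε i ∪ forestCross T ε ξ f (fun j => R.graph j 0) i :=
  (R.enum i hi).mapsTo hk

lemma cross_spec (hsep : ∀ a b : X, a ≠ b → 64 ≤ dist a b) (hε : 0 < ε) {i k : ℕ}
    (hi : i < topLevel X) (hk : k < R.num i) :
    R.x i k ∈ T.net i ∧ R.y i k ∈ T.net i ∧ 64 * rad i ≤ dist (R.x i k) (R.y i k) ∧
      dist (R.x i k) (R.y i k) ≤ lam ε * rad i :=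
  (R.mem_cross hi hk).elim (guidedCross_spec hsep hε) forestCross_spec

/-- Since the two ends of a cross edge are at distance at least `64 r_i`, its surrogate sets, which
lie within `16 r_i` of them, are disjoint. -/
lemma edge_spec (hsep : ∀ a b : X, a ≠ b → 64 ≤ dist a b) (hε : 0 < ε) {i k : ℕ}
    (hi : i < topLevel X) (hk : k < R.num i) {e : Sym2 X} (he : e ∈ R.M i k) :
    ¬ e.IsDiag ∧ edgeLen e ≤ 2 * lam ε * rad i := by
  obtain ⟨⟨a, b⟩, ⟨ha, hb⟩, rfl⟩ := (R.connection i hi k hk).subset_image he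
  obtain ⟨-, -, h1, h2⟩ := R.cross_spec hsep hε hi hk
  have h3 := (R.surrogate_x i hi k hk).dist_le hi.le ha
  have h4 := (R.surrogate_y i hi k hk).dist_le hi.le hb
  have hr := rad_pos i
  have hl : 5 ^ 20 * rad i ≤ lam ε * rad i := by gcongr; exact le_lam hε
  dsimp only at h3 h4 ⊢
  constructor
  · rw [Sym2.mk_isDiag_iff]
    rintro rfl
    have := dist_triangle_right (R.x i k) (R.y i k) a
    linarith
  · have := dist_triangle4 a (R.x i k) (R.y i k) b
    rw [dist_comm a (R.x i k)] at this
    rw [edgeLen_mk]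
    linarith

lemma edgeSet_graph_inner {i : ℕ} (hi : i < topLevel X) {k : ℕ} (hk : k ≤ R.num i) :
    (R.graph i k).edgeSet =
      (R.graph i 0).edgeSet ∪ {e | ∃ l < k, e ∈ R.M i l ∧ ¬ e.IsDiag} := by
  induction k with
  | zero => simp
  | succ k ih =>
    rw [R.graph_step i hi k hk, SimpleGraph.edgeSet_sup, ih (by omega),
      SimpleGraph.edgeSet_fromEdgeSet, union_assoc]
    congr 1
    ext e
    simp only [mem_union, mem_ofPred_eq, mem_sdiff, Nat.lt_succ_iff_lt_or_eq, Sym2.mem_diagSet]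
    constructor
    · rintro (⟨l, hl, h⟩ | h)
      exacts [⟨l, Or.inl hl, h⟩, ⟨k, Or.inr rfl, h⟩]
    · rintro ⟨l, hl | rfl, h⟩
      exacts [Or.inl ⟨l, hl, h⟩, Or.inr h]

lemma edgeSet_graph {i : ℕ} (hi : i ≤ topLevel X) :
    (R.graph i 0).edgeSet = {e | ∃ j < i, ∃ k < R.num j, e ∈ R.M j k ∧ ¬ e.IsDiag} := by
  induction i with
  | zero => simp [R.graph_zero]
  | succ i ih =>
    rw [R.graph_next i hi, R.edgeSet_graph_inner hi le_rfl, ih (by omega)]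
    ext e
    simp only [mem_union, mem_ofPred_eq, Nat.lt_succ_iff_lt_or_eq]
    constructor
    · rintro (⟨j, hj, h⟩ | h)
      exacts [⟨j, Or.inl hj, h⟩, ⟨i, Or.inr rfl, h⟩]
    · rintro ⟨j, hj | rfl, h⟩
      exacts [Or.inl ⟨j, hj, h⟩, Or.inr h]

lemma edgeSet_output (hsep : ∀ a b : X, a ≠ b → 64 ≤ dist a b) (hε : 0 < ε) :
    R.output.edgeSet = R.EO ∪ R.Einc ∪ R.Ecom := by
  rw [output, R.edgeSet_graph le_rfl]
  ext e
  constructor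
  · rintro ⟨i, hi, k, hk, he, -⟩
    by_cases h1 : s(R.x i k, R.y i k) ∈ guidedCross G T ε i
    · exact Or.inl (Or.inl ⟨i, k, hi, hk, he, h1⟩)
    by_cases h2 : R.Incomplete i (R.x i k) ∨ R.Incomplete i (R.y i k)
    · exact Or.inl (Or.inr ⟨i, k, hi, hk, he, h1, h2⟩)
    · rw [not_or] at h2
      exact Or.inr ⟨i, k, hi, hk, he, h1, h2⟩
  · rintro ((⟨i, k, hi, hk, he, -⟩ | ⟨i, k, hi, hk, he, -⟩) | ⟨i, k, hi, hk, he, -⟩) <;>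
      exact ⟨i, hi, k, hk, he, (R.edge_spec hsep hε hi hk he).1⟩

lemma dist_le_of_adj (hsep : ∀ a b : X, a ≠ b → 64 ≤ dist a b) (hε : 0 < ε) {i : ℕ}
    (hi : i ≤ topLevel X) {a b : X} (h : (R.graph i 0).Adj a b) : dist a b ≤ 2 * lam ε * rad i := by
  rw [← SimpleGraph.mem_edgeSet, R.edgeSet_graph hi] at h
  obtain ⟨j, hj, k, hk, he, -⟩ := h
  refine (R.edge_spec hsep hε (by omega) hk he).2.trans ?_
  have := rad_mono hj.le
  have := le_lam hε
  gcongr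

/-- The `k`-th cross edge processed at level `i` lies near the point `p`, and its level is in the
window above `l`. -/
def Near (p : X) (l i k : ℕ) : Prop :=
  l ≤ i ∧ i ≤ l + window ε ∧ dist p (R.x i k) ≤ 5 * lam ε * rad i ∧
    dist p (R.y i k) ≤ 5 * lam ε * rad i

lemma finite_near (p : X) (l : ℕ) :
    {q : ℕ × ℕ | q.1 < topLevel X ∧ q.2 < R.num q.1 ∧ R.Near p l q.1 q.2}.Finite := by
  refine Set.Finite.subset (s := ⋃ i ∈ Finset.range (topLevel X), Prod.mk i '' Iio (R.num i))
    (Set.Finite.biUnion (Finset.finite_toSet _) fun i _ => (Set.finite_Iio _).image _) ?_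
  rintro ⟨i, k⟩ ⟨hi, hk, -⟩
  simp only [mem_iUnion]
  exact ⟨i, by simpa using hi, k, hk, rfl⟩

variable [Finite X]

lemma weight_M_le (hsep : ∀ a b : X, a ≠ b → 64 ≤ dist a b) (hε : 0 < ε) {i k : ℕ}
    (hi : i < topLevel X) (hk : k < R.num i) {m n : ℕ} (hx : (R.Sx i k).ncard ≤ m)
    (hy : (R.Sy i k).ncard ≤ n) : weight (R.M i k) ≤ m * n * (2 * lam ε * rad i) := by
  refine (weight_le_card_mul fun e he => (R.edge_spec hsep hε hi hk he).2).trans ?_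
  have h : (R.M i k).ncard ≤ m * n :=
    (R.connection i hi k hk).ncard_le.trans (Nat.mul_le_mul hx hy)
  have := rad_pos i
  have := le_lam hε
  gcongr
  exact_mod_cast h

lemma weight_M_le_sq (hsep : ∀ a b : X, a ≠ b → 64 ≤ dist a b) (hε : 0 < ε) {i k : ℕ}
    (hi : i < topLevel X) (hk : k < R.num i) :
    weight (R.M i k) ≤ (f + 1) ^ 2 * (2 * lam ε * rad i) := by
  have := R.weight_M_le hsep hε hi hk (R.surrogate_x i hi k hk).ncard_le
    (R.surrogate_y i hi k hk).ncard_le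
  push_cast at this
  linarith

/-- A bound for the number of cross edges near a given point, with levels in a given window. -/
noncomputable def nearBound (ε d : ℝ) : ℝ := (window ε + 1) * ((20 * lam ε) ^ d) ^ 2

lemma ncard_level_near_le (hsep : ∀ a b : X, a ≠ b → 64 ≤ dist a b) (hε : 0 < ε) {d : ℝ}
    (hd0 : 0 ≤ d) (hd : DoublingDimLE X d) (p : X) (l i : ℕ) :
    ({k | i < topLevel X ∧ k < R.num i ∧ R.Near p l i k}.ncard : ℝ) ≤ ((20 * lam ε) ^ d) ^ 2 := by
  by_cases hi : i < topLevel X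
  swap
  · simp only [hi, false_and, ofPred_false, ncard_empty, Nat.cast_zero]
    positivity
  have hr := rad_pos i
  have hlam := le_lam hε
  set V := {z | z ∈ T.net i ∧ dist p z ≤ 5 * lam ε * rad i}
  have hV : (V.ncard : ℝ) ≤ (20 * lam ε) ^ d := by
    have := ncard_le_of_separated hd0 hd (r := rad i) (R := 5 * lam ε * rad i) (p := p) (A := V) hr
      (by nlinarith) (fun z hz => by rw [Metric.mem_closedBall, dist_comm]; exact hz.2)
      (fun a ha b hb => T.rad_le_dist hsep hi.le ha.1 hb.1)
    rwa [show 4 * (5 * lam ε * rad i) / rad i = 20 * lam ε by field_simp; ring] at this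
  have hle : {k | i < topLevel X ∧ k < R.num i ∧ R.Near p l i k}.ncard ≤ (V ×ˢ V).ncard := by
    refine le_trans ?_ (Set.ncard_image_le (f := fun q : X × X => s(q.1, q.2)) (Set.toFinite _))
    refine Set.ncard_le_ncard_of_injOn (fun k => s(R.x i k, R.y i k)) ?_ ?_ (Set.toFinite _)
    · rintro k ⟨-, hk, hn⟩
      obtain ⟨h1, h2, -⟩ := R.cross_spec hsep hε hi hk
      exact ⟨(R.x i k, R.y i k), ⟨⟨h1, hn.2.2.1⟩, ⟨h2, hn.2.2.2⟩⟩, rfl⟩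
    · exact (R.enum i hi).injOn.mono fun k hk => hk.2.1
  rw [Set.ncard_prod] at hle
  calc (_ : ℝ) ≤ (V.ncard : ℝ) * V.ncard := by exact_mod_cast hle
    _ ≤ (20 * lam ε) ^ d * (20 * lam ε) ^ d := by gcongr
    _ = _ := by ring

lemma ncard_near_le (hsep : ∀ a b : X, a ≠ b → 64 ≤ dist a b) (hε : 0 < ε) {d : ℝ}
    (hd0 : 0 ≤ d) (hd : DoublingDimLE X d) (p : X) (l : ℕ) :
    ({q : ℕ × ℕ | q.1 < topLevel X ∧ q.2 < R.num q.1 ∧ R.Near p l q.1 q.2}.ncard : ℝ) ≤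
      nearBound ε d := by
  have hsub : {q : ℕ × ℕ | q.1 < topLevel X ∧ q.2 < R.num q.1 ∧ R.Near p l q.1 q.2} ⊆
      ⋃ i ∈ Finset.Icc l (l + window ε),
        Prod.mk i '' {k | i < topLevel X ∧ k < R.num i ∧ R.Near p l i k} := by
    rintro ⟨i, k⟩ ⟨hi, hk, hn⟩
    simp only [mem_iUnion]
    exact ⟨i, Finset.mem_Icc.2 ⟨hn.1, hn.2.1⟩, k, ⟨hi, hk, hn⟩, rfl⟩
  have hfin : ∀ i, {k | i < topLevel X ∧ k < R.num i ∧ R.Near p l i k}.Finite := fun i =>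
    (Set.finite_Iio (R.num i)).subset fun k hk => hk.2.1
  have h1 := (Set.ncard_le_ncard hsub (Set.Finite.biUnion (Finset.finite_toSet _)
    fun i _ => (hfin i).image _)).trans (Finset.set_ncard_biUnion_le _ _)
  have h2 : ∀ i ∈ Finset.Icc l (l + window ε),
      ((Prod.mk i '' {k | i < topLevel X ∧ k < R.num i ∧ R.Near p l i k}).ncard : ℝ) ≤
        ((20 * lam ε) ^ d) ^ 2 := fun i _ =>
    le_trans (by exact_mod_cast Set.ncard_image_le (hfin i))
      (R.ncard_level_near_le hsep hε hd0 hd p l i)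
  have h3 := Finset.sum_le_card_nsmul _ _ _ h2
  rw [Nat.card_Icc, nsmul_eq_mul] at h3
  refine (le_trans (by exact_mod_cast h1) h3).trans (le_of_eq ?_)
  rw [nearBound, show l + window ε + 1 - l = window ε + 1 by omega]
  push_cast
  rfl

/-- The charging scheme: if each of the bipartite connections that make up `E` is paid for by a
target near its cross edge, then the weight of `E` is bounded by the total budget of the targets,
up to the number of cross edges near a target. -/
lemma weight_le_of_charge (hsep : ∀ a b : X, a ≠ b → 64 ≤ dist a b) (hε : 0 < ε) {d : ℝ}
    (hd0 : 0 ≤ d) (hd : DoublingDimLE X d) {ι : Type*} (J : Finset ι) (p : ι → X) (l : ι → ℕ)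
    (g : ι → ℝ) (hg : ∀ τ ∈ J, 0 ≤ g τ) {E : Set (Sym2 X)}
    (hE : ∀ e ∈ E, ∃ i k, i < topLevel X ∧ k < R.num i ∧ e ∈ R.M i k ∧
      ∃ τ ∈ J, R.Near (p τ) (l τ) i k ∧ weight (R.M i k) ≤ g τ) :
    weight E ≤ nearBound ε d * ∑ τ ∈ J, g τ := by
  classical
  set A : ι → Finset (ℕ × ℕ) := fun τ =>
    (R.finite_near (p τ) (l τ)).toFinset.filter fun q => weight (R.M q.1 q.2) ≤ g τ with hA
  have hsub : E ⊆ ⋃ τ ∈ J, ⋃ q ∈ A τ, R.M q.1 q.2 := by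
    intro e he
    obtain ⟨i, k, hi, hk, heM, τ, hτ, hn, hw⟩ := hE e he
    simp only [mem_iUnion]
    exact ⟨τ, hτ, (i, k), by simp [hA, hi, hk, hn, hw], heM⟩
  rw [Finset.mul_sum]
  refine (weight_mono hsub).trans ((weight_biUnion_le _ _).trans (Finset.sum_le_sum fun τ hτ => ?_))
  have hcard : ((A τ).card : ℝ) ≤ nearBound ε d := by
    refine le_trans ?_ (R.ncard_near_le hsep hε hd0 hd (p τ) (l τ))
    rw [Set.ncard_eq_toFinset_card _ (R.finite_near (p τ) (l τ))]
    exact_mod_cast Finset.card_filter_le _ _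
  calc weight (⋃ q ∈ A τ, R.M q.1 q.2) ≤ ∑ q ∈ A τ, weight (R.M q.1 q.2) := weight_biUnion_le _ _
    _ ≤ (A τ).card * g τ := by
        rw [← nsmul_eq_mul]
        exact Finset.sum_le_card_nsmul _ _ _ fun q hq => (Finset.mem_filter.1 hq).2
    _ ≤ nearBound ε d * g τ := by gcongr; exact hg τ hτ

end Run

/-! ### Sums over nodes of the net-tree -/

section NodeSums

variable {X : Type*} [MetricSpace X]

/-- The node `(w, j)` has few points in its immediate vicinity and many in a ball whose radius is
larger by a factor that depends only on `ε`. -/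
def IsFrontier (T : NetTree X) (ε : ℝ) (f : ℕ) (q : X × ℕ) : Prop :=
  q.2 < topLevel X ∧ q.1 ∈ T.net q.2 ∧ {a | dist q.1 a < rad q.2 / 4}.ncard ≤ f ∧
    f + 1 ≤ {a | dist q.1 a ≤ 5 * lam ε ^ 6 * rad q.2}.ncard

variable [Finite X] {T : NetTree X} {ε : ℝ} {f : ℕ}

/-- At a frontier node of level `j`, the distance to the `f`-th nearest point is comparable to
`r_j`. As that distance is a `1`-Lipschitz function, frontier nodes of very different levels are
far apart. -/
lemma IsFrontier.rad_le_dist {σ τ : X × ℕ} (hσ : IsFrontier T ε f σ) (hτ : IsFrontier T ε f τ)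
    (h : 40 * lam ε ^ 6 * rad σ.2 ≤ rad τ.2) : rad τ.2 / 8 ≤ dist σ.1 τ.1 := by
  by_contra! hlt
  have hsub : {a | dist σ.1 a ≤ 5 * lam ε ^ 6 * rad σ.2} ⊆ {a | dist τ.1 a < rad τ.2 / 4} := by
    intro a ha
    have h1 := dist_triangle_left τ.1 a σ.1
    have h2 : dist σ.1 a ≤ 5 * lam ε ^ 6 * rad σ.2 := ha
    change dist τ.1 a < _
    linarith
  have := hσ.2.2.2.trans ((Set.ncard_le_ncard hsub (Set.toFinite _)).trans hτ.2.2.1)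
  omega

lemma sum_rad_frontier_le [Nonempty X] (hsep : ∀ a b : X, a ≠ b → 64 ≤ dist a b) (hε : 0 < ε)
    (J : Finset (X × ℕ)) (hJ : ∀ q ∈ J, IsFrontier T ε f q) :
    ∑ q ∈ J, rad q.2 ≤ 41 * lam ε ^ 6 * (16 * mstWeight X) := by
  classical
  set s := ⌈40 * lam ε ^ 6⌉₊
  have hlam := le_lam hε
  have hlam6 : 1 ≤ lam ε ^ 6 := one_le_pow₀ (by linarith)
  have hspos : 0 < s := Nat.ceil_pos.2 (by positivity)
  have hs1 : 40 * lam ε ^ 6 ≤ 5 ^ s :=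
    calc 40 * lam ε ^ 6 ≤ s := Nat.le_ceil _
      _ ≤ 5 ^ s := by exact_mod_cast (Nat.lt_pow_self (by norm_num : 1 < 5)).le
  have hs2 : (s : ℝ) ≤ 41 * lam ε ^ 6 := by
    have := Nat.ceil_lt_add_one (a := 40 * lam ε ^ 6) (by positivity)
    linarith
  -- Within a residue class modulo `s`, different levels differ by a factor of at least `5 ^ s`.
  have hclass : ∀ c ∈ Finset.range s, ∑ q ∈ J with q.2 % s = c, rad q.2 ≤ 16 * mstWeight X := by
    intro c _
    refine sum_rad_le_mstWeight _ Prod.fst Prod.snd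
      (fun q hq => (hJ q (Finset.mem_filter.1 hq).1).1) fun σ hσ τ hτ hne hle => ?_
    rw [Finset.mem_filter] at hσ hτ
    have fσ := hJ σ hσ.1
    have fτ := hJ τ hτ.1
    rcases hle.eq_or_lt with heq | hlt
    · have hne' : σ.1 ≠ τ.1 := fun h => hne (Prod.ext h heq)
      have := T.rad_le_dist hsep fτ.1.le (heq ▸ fσ.2.1) fτ.2.1 hne'
      linarith [rad_pos τ.2]
    · have hdvd : s ∣ τ.2 - σ.2 := (Nat.modEq_iff_dvd' hle).1 (hσ.2.trans hτ.2.symm)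
      have hge := Nat.le_of_dvd (by omega) hdvd
      refine fσ.rad_le_dist fτ ?_
      calc 40 * lam ε ^ 6 * rad σ.2 ≤ 5 ^ s * rad σ.2 := by gcongr; exact (rad_pos _).le
        _ = rad (σ.2 + s) := by rw [rad_add]; ring
        _ ≤ rad τ.2 := rad_mono (by omega)
  rw [← Finset.sum_fiberwise_of_maps_to (t := Finset.range s) (g := fun q => q.2 % s)
    (fun q _ => Finset.mem_range.2 (Nat.mod_lt _ hspos))]
  have hm := (mstWeight_nonneg : 0 ≤ mstWeight X)
  calc _ ≤ (Finset.range s).card • (16 * mstWeight X) := Finset.sum_le_card_nsmul _ _ _ hclass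
    _ = s * (16 * mstWeight X) := by rw [Finset.card_range, nsmul_eq_mul]
    _ ≤ _ := by gcongr

lemma sum_range_rad_le (t : ℕ) : ∑ j ∈ Finset.range (t + 1), rad j ≤ 5 / 4 * rad t := by
  induction t with
  | zero => norm_num [rad]
  | succ t ih => rw [Finset.sum_range_succ, rad_succ]; linarith

/-- The ancestors of a leaf contribute a geometric sum, dominated by the topmost node of the family
above that leaf. These topmost nodes form an antichain, so that the packing bound applies. -/
lemma sum_ncard_leaves_mul_rad_le [Nonempty X] (hsep : ∀ a b : X, a ≠ b → 64 ≤ dist a b)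
    (J : Finset (X × ℕ)) (hlvl : ∀ q ∈ J, q.2 < topLevel X) (hnet : ∀ q ∈ J, q.1 ∈ T.net q.2)
    (hleaves : ∀ q ∈ J, (T.leaves q.2 q.1).ncard ≤ f) :
    ∑ q ∈ J, ((T.leaves q.2 q.1).ncard : ℝ) * rad q.2 ≤ 20 * f * mstWeight X := by
  classical
  have := Fintype.ofFinite X
  have hcard : ∀ q : X × ℕ, (T.leaves q.2 q.1).ncard =
      (Finset.univ.filter fun a => T.anc a q.2 = q.1).card := by
    intro q
    rw [Set.ncard_eq_toFinset_card _ (Set.toFinite _)]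
    congr 1
    ext a
    simp [NetTree.leaves]
  set A : Finset X := Finset.univ.filter fun a => ∃ q ∈ J, T.anc a q.2 = q.1 with hA
  have htop : ∀ a ∈ A, ∃ q, q ∈ J ∧ T.anc a q.2 = q.1 ∧
      ∀ q' ∈ J, T.anc a q'.2 = q'.1 → q'.2 ≤ q.2 := by
    intro a ha
    obtain ⟨q₀, hq₀, ha₀⟩ := (Finset.mem_filter.1 ha).2
    obtain ⟨q, hq, hmax⟩ := (J.filter fun q => T.anc a q.2 = q.1).exists_max_image Prod.snd
      ⟨q₀, Finset.mem_filter.2 ⟨hq₀, ha₀⟩⟩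
    rw [Finset.mem_filter] at hq
    exact ⟨q, hq.1, hq.2, fun q' h1 h2 => hmax q' (Finset.mem_filter.2 ⟨h1, h2⟩)⟩
  choose! top htopJ htopa htopmax using htop
  have h1 : ∑ q ∈ J, ((T.leaves q.2 q.1).ncard : ℝ) * rad q.2 =
      ∑ a ∈ A, ∑ q ∈ J with T.anc a q.2 = q.1, rad q.2 := by
    have : ∀ q ∈ J, ((T.leaves q.2 q.1).ncard : ℝ) * rad q.2 =
        ∑ a ∈ Finset.univ.filter fun a => T.anc a q.2 = q.1, rad q.2 := by
      intro q _
      rw [hcard, Finset.sum_const, nsmul_eq_mul]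
    rw [Finset.sum_congr rfl this]
    refine Finset.sum_comm' fun q a => ?_
    simp only [hA, Finset.mem_filter, Finset.mem_univ, true_and]
    exact ⟨fun h => ⟨h, q, h⟩, fun h => h.1⟩
  have h2 : ∀ a ∈ A, ∑ q ∈ J with T.anc a q.2 = q.1, rad q.2 ≤ 5 / 4 * rad (top a).2 := by
    intro a ha
    refine le_trans ?_ (sum_range_rad_le _)
    have hinj : Set.InjOn Prod.snd (J.filter fun q => T.anc a q.2 = q.1 : Set (X × ℕ)) := by
      intro q hq q' hq' h
      simp only [Finset.coe_filter, mem_ofPred_eq] at hq hq'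
      exact Prod.ext (by rw [← hq.2, ← hq'.2, h]) h
    rw [← Finset.sum_image (f := rad) (by simpa using hinj)]
    refine Finset.sum_le_sum_of_subset_of_nonneg ?_ fun j _ _ => (rad_pos j).le
    intro j hj
    obtain ⟨q, hq, rfl⟩ := Finset.mem_image.1 hj
    rw [Finset.mem_filter] at hq
    exact Finset.mem_range.2 (Nat.lt_succ_of_le (htopmax a ha q hq.1 hq.2))
  have h3 : ∑ a ∈ A, rad (top a).2 ≤ f * ∑ q ∈ A.image top, rad q.2 := by
    rw [← Finset.sum_fiberwise_of_maps_to (t := A.image top) (g := top)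
      (fun a ha => Finset.mem_image_of_mem _ ha), Finset.mul_sum]
    refine Finset.sum_le_sum fun q hq => ?_
    obtain ⟨b, hb, rfl⟩ := Finset.mem_image.1 hq
    have hle : (A.filter fun a => top a = top b).card ≤ f := by
      refine le_trans ?_ (hleaves _ (htopJ b hb))
      rw [hcard]
      refine Finset.card_le_card fun a ha => ?_
      rw [Finset.mem_filter] at ha
      simpa [← ha.2] using htopa a ha.1
    calc ∑ a ∈ A with top a = top b, rad (top a).2
        = (A.filter fun a => top a = top b).card * rad (top b).2 := by
          rw [← nsmul_eq_mul, ← Finset.sum_const]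
          exact Finset.sum_congr rfl fun a ha => by rw [(Finset.mem_filter.1 ha).2]
      _ ≤ f * rad (top b).2 := by
          have := rad_pos (top b).2
          gcongr
  have h4 : ∑ q ∈ A.image top, rad q.2 ≤ 16 * mstWeight X := by
    refine sum_rad_le_mstWeight _ Prod.fst Prod.snd ?_ ?_
    · intro q hq
      obtain ⟨a, ha, rfl⟩ := Finset.mem_image.1 hq
      exact hlvl _ (htopJ a ha)
    · intro σ hσ τ hτ hne hle
      obtain ⟨a, ha, rfl⟩ := Finset.mem_image.1 hσ
      obtain ⟨b, hb, rfl⟩ := Finset.mem_image.1 hτ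
      by_contra! hlt
      have ja := htopJ a ha
      have jb := htopJ b hb
      have e1 : T.anc (top a).1 (top b).2 = (top b).1 :=
        T.anc_eq_of_dist_lt hsep (hlvl _ jb).le (hnet _ jb) (by
          rw [dist_comm]; linarith [rad_pos (top b).2])
      have e2 : T.anc (top a).1 (top a).2 = T.anc a (top a).2 := by
        rw [T.anc_self hsep (hlvl _ ja).le (hnet _ ja), htopa a ha]
      have e3 : T.anc a (top b).2 = (top b).1 := by rw [← T.anc_eq_anc hle e2, e1]
      have e4 : (top a).2 = (top b).2 := le_antisymm hle (htopmax a ha _ jb e3)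
      exact hne (Prod.ext (by rw [← htopa a ha, ← e3, e4]) e4)
  calc _ = ∑ a ∈ A, ∑ q ∈ J with T.anc a q.2 = q.1, rad q.2 := h1
    _ ≤ ∑ a ∈ A, 5 / 4 * rad (top a).2 := Finset.sum_le_sum h2
    _ = 5 / 4 * ∑ a ∈ A, rad (top a).2 := by rw [Finset.mul_sum]
    _ ≤ 5 / 4 * (f * (16 * mstWeight X)) := by
        gcongr
        exact h3.trans (by gcongr)
    _ = _ := by ring

end NodeSums

/-! ### The three parts of the spanner -/

namespace Run

variable {X : Type*} [MetricSpace X] [Finite X] {G : SimpleGraph X} {T : NetTree X} {ε ξ : ℝ}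
  {f : ℕ} (R : Run G T ε ξ f)

/-- The edges of `E_O` are charged to the edges of `G` that they originate from. -/
lemma weight_EO_le (hsep : ∀ a b : X, a ≠ b → 64 ≤ dist a b) (hε : 0 < ε) {d : ℝ}
    (hd0 : 0 ≤ d) (hd : DoublingDimLE X d) :
    weight R.EO ≤ nearBound ε d * ((f + 1) ^ 2 * (2 * lam ε ^ 6) * weight G.edgeSet) := by
  have hlam := le_lam hε
  set l : Sym2 X → ℕ := fun e => sInf {j | j ≤ topLevel X ∧
    dist (T.anc (Quot.out e).1 j) (T.anc (Quot.out e).2 j) ≤ lam ε * rad j}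
  have h := R.weight_le_of_charge hsep hε hd0 hd G.edgeSet.toFinite.toFinset
    (fun e => (Quot.out e).1) l (fun e => (f + 1) ^ 2 * (2 * lam ε ^ 6) * edgeLen e)
    (fun e _ => by have := edgeLen_nonneg e; positivity) (E := R.EO) ?_
  · rwa [← Finset.mul_sum, ← weight_eq_sum] at h
  rintro e ⟨i, k, hi, hk, he, hg⟩
  obtain ⟨a, b, i₀, hab, hi₀, h1, h2, hnear⟩ := exists_of_mem_guidedCross hε hg
  refine ⟨i, k, hi, hk, he, s(a, b), by simpa using hab, ?_⟩
  have hout : s((Quot.out s(a, b)).1, (Quot.out s(a, b)).2) = s(a, b) := Quot.out_eq s(a, b)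
  have hor : IsOriginalLevel T ε (Quot.out s(a, b)).1 (Quot.out s(a, b)).2 i₀ := by
    rcases Sym2.eq_iff.1 hout with ⟨e1, e2⟩ | ⟨e1, e2⟩ <;> rw [e1, e2]
    exacts [hi₀, hi₀.symm]
  have hlev : l s(a, b) = i₀ := hor.csInf_eq
  have hp : (Quot.out s(a, b)).1 = a ∨ (Quot.out s(a, b)).1 = b := by
    rcases Sym2.eq_iff.1 hout with ⟨e1, e2⟩ | ⟨e1, e2⟩
    exacts [Or.inl e1, Or.inr e1]
  refine ⟨⟨hlev ▸ h1, hlev ▸ h2, hnear _ hp⟩, (R.weight_M_le_sq hsep hε hi hk).trans ?_⟩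
  have h3 := (rad_le_of_le_add_window hε h2).trans
    (mul_le_mul_of_nonneg_left (hi₀.rad_le_dist hsep hε hab.ne) (by positivity))
  rw [edgeLen_mk]
  calc ((f : ℝ) + 1) ^ 2 * (2 * lam ε * rad i)
      ≤ (f + 1) ^ 2 * (2 * lam ε * (lam ε ^ 5 * dist a b)) := by gcongr
    _ = _ := by ring

/-- There are many points near a complete node: its leaves if it is small, and otherwise the
neighbours in `H` of a leaf of large degree. -/
lemma lt_ncard_of_complete (hsep : ∀ a b : X, a ≠ b → 64 ≤ dist a b) (hε : 0 < ε) (hξ : 1 ≤ ξ)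
    (hf : 1 ≤ f) {i : ℕ} (hi : i < topLevel X) {x : X} (hx : ¬ R.Incomplete i x) :
    f + 1 ≤ {a | dist x a ≤ 3 * lam ε * rad i}.ncard := by
  have hlam := le_lam hε
  have hr := rad_pos i
  have hl : 5 ^ 20 * rad i ≤ lam ε * rad i := by gcongr
  by_cases hsmall : IsSmall T ε ξ f (R.graph i 0) i x
  · have h1 : f < (T.leaves i x).ncard := by
      by_contra! h
      exact hx ⟨hsmall, h⟩
    refine h1.trans_le (Set.ncard_le_ncard (fun a ha => ?_) (Set.toFinite _))
    have := T.dist_le_of_mem_leaves hi.le ha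
    rw [mem_ofPred_eq]
    linarith
  · unfold IsSmall at hsmall
    push Not at hsmall
    obtain ⟨u, hu, hdeg⟩ := hsmall
    have hc : (f : ℝ) ≤ c₁ ε ξ * f := by
      have hlog : 1 ≤ logLam ε := by
        rw [logLam, Real.le_logb_iff_rpow_le (by norm_num) (by linarith)]
        exact le_trans (by norm_num) hlam
      have : 1 ≤ c₁ ε ξ := by unfold c₁; nlinarith
      exact le_mul_of_one_le_left (by positivity) this
    have h1 : f < deg (R.graph i 0) u := by exact_mod_cast hc.trans_lt hdeg
    refine h1.trans_le (Set.ncard_le_ncard (fun a ha => ?_) (Set.toFinite _))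
    have h2 := R.dist_le_of_adj hsep hε hi.le ((SimpleGraph.mem_neighborSet _ _ _).1 ha)
    have h3 := T.dist_le_of_mem_leaves hi.le hu
    have h4 := dist_triangle x u a
    rw [mem_ofPred_eq]
    linarith

/-- The edges of `E_com` are charged to the incomplete nodes that caused them; with a complete node
nearby, these are frontier nodes. -/
lemma weight_Ecom_le [Nonempty X] (hsep : ∀ a b : X, a ≠ b → 64 ≤ dist a b) (hε : 0 < ε)
    (hξ : 1 ≤ ξ) (hf : 1 ≤ f) {d : ℝ} (hd0 : 0 ≤ d) (hd : DoublingDimLE X d) :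
    weight R.Ecom ≤ nearBound ε d * ((f + 1) ^ 2 * (2 * lam ε ^ 6) *
      (41 * lam ε ^ 6 * (16 * mstWeight X))) := by
  have hlam := le_lam hε
  have hlam0 : 0 < lam ε := lt_of_lt_of_le (by norm_num) hlam
  have hfin : {q : X × ℕ | IsFrontier T ε f q}.Finite :=
    (Set.finite_univ.prod (Set.finite_Iio (topLevel X))).subset fun q hq => ⟨mem_univ _, hq.1⟩
  have hnb : 0 ≤ nearBound ε d := by unfold nearBound; positivity
  have h := R.weight_le_of_charge hsep hε hd0 hd hfin.toFinset Prod.fst Prod.snd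
    (fun q => (f + 1) ^ 2 * (2 * lam ε ^ 6) * rad q.2)
    (fun q _ => by have := rad_pos q.2; positivity) (E := R.Ecom) ?_
  · rw [← Finset.mul_sum] at h
    refine h.trans ?_
    gcongr
    exact sum_rad_frontier_le hsep hε _ fun q hq => by simpa using hq
  rintro e ⟨i, k, hi, hk, he, hg, hx, -⟩
  obtain ⟨z, hz, ⟨j, w, hdesc, hwin, hinc⟩, -, hcr⟩ := (R.mem_cross hi hk).resolve_left hg
  obtain ⟨⟨-, hzx⟩, ⟨-, hzy⟩, -⟩ := mem_cross_iff.1 hcr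
  have hji := hdesc.2.1
  have hiw : i ≤ j + window ε := le_add_window (by linarith)
  have hwz := hdesc.dist_le hi.le
  have hr := rad_pos i
  have hl : 5 ^ 20 * rad i ≤ lam ε * rad i := by gcongr
  have hwx := dist_triangle w z (R.x i k)
  have hwy := dist_triangle w z (R.y i k)
  have hrad := rad_le_of_le_add_window hε hiw
  refine ⟨i, k, hi, hk, he, (w, j), ?_, ⟨hji, hiw, by dsimp only; linarith,
    by dsimp only; linarith⟩, ?_⟩
  · rw [Set.Finite.mem_toFinset]
    refine ⟨hji.trans_lt hi, hdesc.1, ?_, ?_⟩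
    · refine (Set.ncard_le_ncard (fun a ha => ?_) (Set.toFinite _)).trans hinc.2
      exact T.anc_eq_of_dist_lt hsep (by omega) hdesc.1 ha
    · refine (R.lt_ncard_of_complete hsep hε hξ hf hi hx).trans
        (Set.ncard_le_ncard (fun a ha => ?_) (Set.toFinite _))
      have h1 : dist (R.x i k) a ≤ 3 * lam ε * rad i := ha
      have h2 := dist_triangle w (R.x i k) a
      have h3 : 5 * lam ε * rad i ≤ 5 * lam ε * (lam ε ^ 5 * rad j) := by gcongr
      change dist w a ≤ 5 * lam ε ^ 6 * rad j
      calc dist w a ≤ 5 * lam ε * rad i := by linarith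
        _ ≤ 5 * lam ε * (lam ε ^ 5 * rad j) := h3
        _ = _ := by ring
  · calc weight (R.M i k) ≤ (f + 1) ^ 2 * (2 * lam ε * rad i) := R.weight_M_le_sq hsep hε hi hk
      _ ≤ (f + 1) ^ 2 * (2 * lam ε * (lam ε ^ 5 * rad j)) := by gcongr
      _ = _ := by ring

/-- The edges of `E_inc` are charged to the incomplete ends of their cross edges, each of which
contributes at most one surrogate per leaf. -/
lemma weight_Einc_le [Nonempty X] (hsep : ∀ a b : X, a ≠ b → 64 ≤ dist a b) (hε : 0 < ε)
    {d : ℝ} (hd0 : 0 ≤ d) (hd : DoublingDimLE X d) :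
    weight R.Einc ≤ nearBound ε d * ((f + 1) * (2 * lam ε) * (20 * f * mstWeight X)) := by
  have hlam := le_lam hε
  have hlam0 : 0 < lam ε := lt_of_lt_of_le (by norm_num) hlam
  have hfin : {q : X × ℕ | q.2 < topLevel X ∧ q.1 ∈ T.net q.2 ∧ R.Incomplete q.2 q.1}.Finite :=
    (Set.finite_univ.prod (Set.finite_Iio (topLevel X))).subset fun q hq => ⟨mem_univ _, hq.1⟩
  have hnb : 0 ≤ nearBound ε d := by unfold nearBound; positivity
  have h := R.weight_le_of_charge hsep hε hd0 hd hfin.toFinset Prod.fst Prod.snd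
    (fun q => (f + 1) * (2 * lam ε) * ((T.leaves q.2 q.1).ncard * rad q.2))
    (fun q _ => by have := rad_pos q.2; positivity) (E := R.Einc) ?_
  · rw [← Finset.mul_sum] at h
    refine h.trans ?_
    gcongr
    exact sum_ncard_leaves_mul_rad_le hsep hfin.toFinset
      (fun q hq => (hfin.mem_toFinset.1 hq).1) (fun q hq => (hfin.mem_toFinset.1 hq).2.1)
      (fun q hq => (hfin.mem_toFinset.1 hq).2.2.2)
  rintro e ⟨i, k, hi, hk, he, -, hinc⟩
  obtain ⟨hx, hy, -, hxy⟩ := R.cross_spec hsep hε hi hk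
  have hr := rad_pos i
  have hl : 0 < lam ε * rad i := by positivity
  have hSx := R.surrogate_x i hi k hk
  have hSy := R.surrogate_y i hi k hk
  refine ⟨i, k, hi, hk, he, ?_⟩
  rcases hinc with hinc | hinc
  · refine ⟨(R.x i k, i), hfin.mem_toFinset.2 ⟨hi, hx, hinc⟩,
      ⟨le_rfl, by dsimp only; omega, ?_, ?_⟩, ?_⟩
    · rw [dist_self]; positivity
    · dsimp only; linarith
    · have := R.weight_M_le hsep hε hi hk (hSx.ncard_le_ncard_leaves hinc) hSy.ncard_le
      push_cast at this
      dsimp only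
      linarith
  · refine ⟨(R.y i k, i), hfin.mem_toFinset.2 ⟨hi, hy, hinc⟩,
      ⟨le_rfl, by dsimp only; omega, ?_, ?_⟩, ?_⟩
    · rw [dist_comm]; dsimp only; linarith
    · rw [dist_self]; positivity
    · have := R.weight_M_le hsep hε hi hk hSx.ncard_le (hSy.ncard_le_ncard_leaves hinc)
      push_cast at this
      dsimp only
      linarith

end Run

/-! ### Constants -/

lemma lam_le_rpow {ε : ℝ} (hε : 0 < ε) (hε2 : ε < 1 / 2) : lam ε ≤ ε ^ (-49 : ℝ) := by
  have h1 : 2 ≤ 1 / ε := by rw [le_div_iff₀ hε]; linarith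
  have h2 : ε ^ (-49 : ℝ) = (1 / ε) ^ 49 := by
    rw [Real.rpow_neg hε.le, one_div, inv_pow]
    norm_cast
  rw [h2, lam]
  calc (5 : ℝ) ^ 20 * (1 + 1 / ε) ≤ 5 ^ 20 * (2 * (1 / ε)) := by gcongr; linarith
    _ ≤ 2 ^ 48 * (1 / ε) := by nlinarith
    _ ≤ (1 / ε) ^ 48 * (1 / ε) := by gcongr
    _ = (1 / ε) ^ 49 := by ring

lemma nearBound_le {ε d : ℝ} (hε : 0 < ε) (hd : 1 ≤ d) :
    Run.nearBound ε d ≤ lam ε ^ (9 * d) := by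
  have hlam := le_lam hε
  have hlam0 : 0 < lam ε := lt_of_lt_of_le (by norm_num) hlam
  have h1 : (window ε : ℝ) + 1 ≤ lam ε ^ (5 * d) := by
    have : (window ε : ℝ) + 1 ≤ 5 ^ window ε := by
      exact_mod_cast Nat.lt_pow_self (by norm_num : 1 < 5)
    refine (this.trans (pow_window_le hε)).trans ?_
    rw [← Real.rpow_natCast]
    exact Real.rpow_le_rpow_of_exponent_le (by linarith) (by push_cast; linarith)
  have h2 : ((20 * lam ε) ^ d) ^ 2 ≤ lam ε ^ (4 * d) := by
    have : (20 * lam ε) ^ d ≤ (lam ε ^ (2 : ℝ)) ^ d := by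
      refine Real.rpow_le_rpow (by positivity) ?_ (by linarith)
      rw [Real.rpow_two]
      nlinarith
    rw [← Real.rpow_mul hlam0.le] at this
    calc ((20 * lam ε) ^ d) ^ 2 ≤ (lam ε ^ (2 * d)) ^ 2 := by gcongr
      _ = lam ε ^ (4 * d) := by
        rw [← Real.rpow_natCast, ← Real.rpow_mul hlam0.le]
        congr 1
        push_cast
        ring
  calc Run.nearBound ε d ≤ lam ε ^ (5 * d) * lam ε ^ (4 * d) := by
        unfold Run.nearBound; gcongr
    _ = lam ε ^ (9 * d) := by rw [← Real.rpow_add hlam0]; congr 1; ring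

/-- The form of the factor in front of `f ^ 2` in the bounds for the three parts. -/
lemma nearBound_mul_le {ε d : ℝ} (hε : 0 < ε) (hd : 1 ≤ d) :
    Run.nearBound ε d * (5248 * lam ε ^ 12) ≤ lam ε ^ (22 * d) := by
  have hlam := le_lam hε
  have hlam0 : 0 < lam ε := lt_of_lt_of_le (by norm_num) hlam
  have h1 : 5248 * lam ε ^ 12 ≤ lam ε ^ (13 * d) :=
    calc 5248 * lam ε ^ 12 ≤ lam ε * lam ε ^ 12 := by gcongr; linarith
      _ = lam ε ^ (13 : ℝ) := by norm_cast; ring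
      _ ≤ lam ε ^ (13 * d) := Real.rpow_le_rpow_of_exponent_le (by linarith) (by linarith)
  calc _ ≤ lam ε ^ (9 * d) * lam ε ^ (13 * d) := by
        gcongr
        exact nearBound_le hε hd
    _ = lam ε ^ (22 * d) := by rw [← Real.rpow_add hlam0]; congr 1; ring

end VFTSpanner

theorem mainTheorem5 :
    ∃ C₀ : ℝ, ∀ C₁ K : ℝ, ∃ C : ℝ,
      ∀ (X : Type*) [MetricSpace X] [Finite X] (d ε ξ : ℝ) (f : ℕ)
        (G : SimpleGraph X) (T : VFTSpanner.NetTree X),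
        (∀ a b : X, a ≠ b → 64 ≤ dist a b) →
        VFTSpanner.DoublingDimLE X d →
        0 < ε → ε < 1 / 2 →
        1 ≤ f → f + 2 ≤ Nat.card X →
        ε ^ (-(C₀ * d)) ≤ ξ → ξ ≤ ε ^ (-(C₁ * d)) →
        VFTSpanner.IsSpanner (1 + ε) G →
        VFTSpanner.lightness G ≤ ε ^ (-(K * d)) →
        ∀ R : VFTSpanner.Run G T ε ξ f,
          VFTSpanner.lightness R.output ≤ ε ^ (-(C * d)) * (f : ℝ) ^ 2 ∧
          R.output.edgeSet = R.EO ∪ R.Einc ∪ R.Ecom ∧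
          VFTSpanner.weight R.EO ≤ ε ^ (-(C * d)) * (f : ℝ) ^ 2 * VFTSpanner.mstWeight X ∧
          VFTSpanner.weight R.Einc ≤ ε ^ (-(C * d)) * (f : ℝ) ^ 2 * VFTSpanner.mstWeight X ∧
          VFTSpanner.weight R.Ecom ≤ ε ^ (-(C * d)) * (f : ℝ) ^ 2 * VFTSpanner.mstWeight X := by
  open VFTSpanner in
  refine ⟨0, fun C₁ K => ⟨49 * 23 + max K 0, ?_⟩⟩
  intro X _ _ d ε ξ f G T hsep hd hε hε2 hf hfn hξ _ _ hG R
  have hnt : Nontrivial X := Finite.one_lt_card_iff_nontrivial.1 (by omega)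
  have hd1 : 1 ≤ d := one_le_of_doublingDimLE hd
  have hd0 : 0 ≤ d := by linarith
  have hξ1 : 1 ≤ ξ := by simpa using hξ
  have hmst : 0 < mstWeight X := mstWeight_pos
  have hlam := le_lam hε
  have hlam0 : 0 < lam ε := lt_of_lt_of_le (by norm_num) hlam
  have hf1 : (1 : ℝ) ≤ f := by exact_mod_cast hf
  have hnb0 : 0 ≤ Run.nearBound ε d := by unfold Run.nearBound; positivity
  have hnb := nearBound_mul_le hε hd1
  set m := mstWeight X
  set L := ε ^ (-(max K 0 * d)) with hL
  have hL1 : 1 ≤ L := Real.one_le_rpow_of_pos_of_le_one_of_nonpos hε (by linarith)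
    (by have := mul_nonneg (le_max_right K 0) hd0; linarith)
  have hGw : weight G.edgeSet ≤ L * m := by
    rw [lightness, div_le_iff₀ hmst] at hG
    refine hG.trans ?_
    gcongr
    refine Real.rpow_le_rpow_of_exponent_ge hε (by linarith) ?_
    have := mul_le_mul_of_nonneg_right (le_max_left K 0) hd0
    linarith
  -- The common bound for the three parts; the factor `3` is absorbed by one more power of `λ`.
  set B := lam ε ^ (22 * d) * L * (f : ℝ) ^ 2 * m with hB
  have hf2 : ((f : ℝ) + 1) ^ 2 ≤ 4 * (f : ℝ) ^ 2 := by nlinarith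
  have hlam12 : lam ε ^ 6 ≤ lam ε ^ 12 := pow_le_pow_right₀ (by linarith) (by norm_num)
  have hlam1 : lam ε ≤ lam ε ^ 12 := le_self_pow₀ (by linarith) (by norm_num)
  have hO : weight R.EO ≤ B := by
    refine (R.weight_EO_le hsep hε hd0 hd).trans ?_
    calc Run.nearBound ε d * ((f + 1) ^ 2 * (2 * lam ε ^ 6) * weight G.edgeSet)
        ≤ Run.nearBound ε d * (4 * (f : ℝ) ^ 2 * (1312 * lam ε ^ 12) * (L * m)) := by
          gcongr
          · exact weight_nonneg _
          · norm_num
      _ = Run.nearBound ε d * (5248 * lam ε ^ 12) * (L * (f : ℝ) ^ 2 * m) := by ring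
      _ ≤ lam ε ^ (22 * d) * (L * (f : ℝ) ^ 2 * m) := by gcongr
      _ = B := by rw [hB]; ring
  have hI : weight R.Einc ≤ B := by
    refine (R.weight_Einc_le hsep hε hd0 hd).trans ?_
    calc Run.nearBound ε d * ((f + 1) * (2 * lam ε) * (20 * f * m))
        ≤ Run.nearBound ε d * ((f + f) * (2 * lam ε ^ 12) * (20 * f * m)) := by gcongr
      _ = Run.nearBound ε d * (80 * lam ε ^ 12) * (1 * (f : ℝ) ^ 2 * m) := by ring
      _ ≤ Run.nearBound ε d * (5248 * lam ε ^ 12) * (L * (f : ℝ) ^ 2 * m) := by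
          gcongr
          norm_num
      _ ≤ lam ε ^ (22 * d) * (L * (f : ℝ) ^ 2 * m) := by gcongr
      _ = B := by rw [hB]; ring
  have hC : weight R.Ecom ≤ B := by
    refine (R.weight_Ecom_le hsep hε hξ1 hf hd0 hd).trans ?_
    calc Run.nearBound ε d * ((f + 1) ^ 2 * (2 * lam ε ^ 6) * (41 * lam ε ^ 6 * (16 * m)))
        ≤ Run.nearBound ε d * (4 * (f : ℝ) ^ 2 * (2 * lam ε ^ 6) *
          (41 * lam ε ^ 6 * (16 * m))) := by gcongr
      _ = Run.nearBound ε d * (5248 * lam ε ^ 12) * (1 * (f : ℝ) ^ 2 * m) := by ring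
      _ ≤ lam ε ^ (22 * d) * (L * (f : ℝ) ^ 2 * m) := by gcongr
      _ = B := by rw [hB]; ring
  have hB0 : 0 ≤ B := by positivity
  have h3B : 3 * B ≤ ε ^ (-((49 * 23 + max K 0) * d)) * (f : ℝ) ^ 2 * m := by
    have h1 : 3 * lam ε ^ (22 * d) ≤ ε ^ (-(49 * 23 * d)) :=
      calc 3 * lam ε ^ (22 * d) ≤ lam ε ^ d * lam ε ^ (22 * d) := by
            gcongr
            calc (3 : ℝ) ≤ lam ε := by linarith
              _ = lam ε ^ (1 : ℝ) := (Real.rpow_one _).symm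
              _ ≤ lam ε ^ d := Real.rpow_le_rpow_of_exponent_le (by linarith) hd1
        _ = lam ε ^ (23 * d) := by rw [← Real.rpow_add hlam0]; congr 1; ring
        _ ≤ (ε ^ (-49 : ℝ)) ^ (23 * d) :=
            Real.rpow_le_rpow hlam0.le (lam_le_rpow hε hε2) (by linarith)
        _ = ε ^ (-(49 * 23 * d)) := by rw [← Real.rpow_mul hε.le]; congr 1; ring
    have h2 : ε ^ (-((49 * 23 + max K 0) * d)) = ε ^ (-(49 * 23 * d)) * L := by
      rw [hL, ← Real.rpow_add hε]; congr 1; ring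
    calc 3 * B = 3 * lam ε ^ (22 * d) * L * (f : ℝ) ^ 2 * m := by rw [hB]; ring
      _ ≤ ε ^ (-(49 * 23 * d)) * L * (f : ℝ) ^ 2 * m := by gcongr
      _ = _ := by rw [h2]
  have hE := R.edgeSet_output hsep hε
  refine ⟨?_, hE, by linarith, by linarith, by linarith⟩
  rw [lightness, div_le_iff₀ hmst, hE]
  have h1 := weight_union_le (R.EO ∪ R.Einc) R.Ecom
  have h2 := weight_union_le R.EO R.Einc
  linarith
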